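/- All graphs are finite and simple. An \emph{MT-partition} of a graph $G$ is a partition of $V(G)$ into two (possibly empty) sets $A,B$ such that $\delta(G[A])\ge |A|-2$ and $\Delta(G[B])\le 1$; $G$ is \emph{Maya-Tupi} if it has an MT-partition, and a \emph{minimal MT-obstruction} is a graph that is not Maya-Tupi but all of whose proper induced subgraphs are. Let $\mathcal F$ be the family of the following eleven forests on nine vertices, each obtained from $3P_3$, with components $0\text{-}1\text{-}2$, $3\text{-}4\text{-}5$ and $6\text{-}7\text{-}8$, by adding at most two edges: no edge ($3P_3$ itself); one edge: $\{2,3\}$, $\{2,4\}$, or $\{1,4\}$; two edges: $\{2,3\},\{5,6\}$; or $\{2,3\},\{5,7\}$; or $\{2,3\},\{4,6\}$; or $\{1,3\},\{4,6\}$; or $\{1,3\},\{4,7\}$; or $\{1,3\},\{5,7\}$; or $\{1,4\},\{5,6\}$. \textbf{Theorem.} Every graph in $\mathcal F$ is acyclic and is a minimal MT-obstruction. Moreover, there is a certifying algorithm that, given a tree $G$ on $n$ vertices $0,\dots,n-1$ by adjacency lists, decides in time $O(n)$ whether $G$ is Maya-Tupi: if $G$ is Maya-Tupi, it answers yes and outputs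 an MT-partition $(A,B)$ of $G$; otherwise it answers no and outputs a member of $\mathcal F$ together with the vertices of an induced copy of it in $G$. Here the running time is measured on a random access machine with finitely many registers and word arrays, with unit-cost assignment, addition, subtraction, indirect load and store, and comparison, all of whose words have values $O(n)$. -/

import Mathlib

/-! ### Graphs -/

namespace MayaTupi

open Classical in
/-- `(A, B)` is an MT-partition of `G`: `A` and `B` (possibly empty) partition the vertex set,
`δ(G[A]) ≥ |A| - 2` and `Δ(G[B]) ≤ 1`. -/
def IsMTPartition {V : Type*} [Fintype V] (G : SimpleGraph V) (A B : Finset V) : Prop :=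
  IsCompl A B ∧
    A.card ≤ (G.induce (A : Set V)).minDegree + 2 ∧
    (G.induce (B : Set V)).maxDegree ≤ 1

/-- `G` is a Maya-Tupi graph. -/
def IsMayaTupi {V : Type*} [Fintype V] (G : SimpleGraph V) : Prop :=
  ∃ A B : Finset V, IsMTPartition G A B

/-- `G` is a minimal MT-obstruction: it is not Maya-Tupi, but each of its proper induced
subgraphs is. -/
def IsMinimalMTObstruction {V : Type*} [Fintype V] (G : SimpleGraph V) : Prop :=
  ¬ IsMayaTupi G ∧ ∀ S : Finset V, S ≠ Finset.univ → IsMayaTupi (G.induce (S : Set V))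

/-- The edges of `3P₃`: the three paths are `0-1-2`, `3-4-5` and `6-7-8`, with centers
`1`, `4` and `7`. -/
def edges3P3 : List (Fin 9 × Fin 9) :=
  [(0, 1), (1, 2), (3, 4), (4, 5), (6, 7), (7, 8)]

/-- The edges added to `3P₃` in each of the eleven forest obstructions. In the labels,
`l` stands for a leaf and `c` for the center of a path. -/
def addedEdges : Fin 11 → List (Fin 9 × Fin 9)
  | 0 => []                    -- the graph 3P₃ itself
  | 1 => [(2, 3)]              -- ll
  | 2 => [(2, 4)]              -- lc
  | 3 => [(1, 4)]              -- cc
  | 4 => [(2, 3), (5, 6)]      -- ll-ll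
  | 5 => [(2, 3), (5, 7)]      -- ll-lc
  | 6 => [(2, 3), (4, 6)]      -- ll-cl
  | 7 => [(1, 3), (4, 6)]      -- cl-cl
  | 8 => [(1, 3), (4, 7)]      -- cl-cc
  | 9 => [(1, 3), (5, 7)]      -- cl-lc
  | 10 => [(1, 4), (5, 6)]     -- cc-ll

/-- The eleven forest obstructions. -/
def forestObstruction (k : Fin 11) : SimpleGraph (Fin 9) :=
  SimpleGraph.fromRel fun i j => (i, j) ∈ edges3P3 ++ addedEdges k

/-! ### Machine model

A random access machine with finitely many registers and finitely many word arrays (a program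
mentions only finitely many of them), programmed by structured three-address code. Every
elementary instruction and every evaluation of a test takes one unit of time. The machine works
with words: a computation in which a value larger than the word bound `W` is computed is not
a valid computation. -/

/-- Memory contents: `reg x` is register `x`, and `arr a i` is cell `i` of array `a`. -/
structure RAMState where
  reg : ℕ → ℕ
  arr : ℕ → ℕ → ℕ

/-- Right-hand sides of assignments; `y` and `z` are names of registers, `a` of an array. -/
inductive Rhs where
  | const (c : ℕ)
  | copy (y : ℕ)
  | add (y z : ℕ)
  | sub (y z : ℕ)
  | load (a y : ℕ)

/-- The value of a right-hand side. Subtraction is truncated at `0`. -/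
def Rhs.eval (s : RAMState) : Rhs → ℕ
  | const c => c
  | copy y => s.reg y
  | add y z => s.reg y + s.reg z
  | sub y z => s.reg y - s.reg z
  | load a y => s.arr a (s.reg y)

/-- Tests; `x` and `y` are names of registers. -/
inductive RAMTest where
  | eq (x y : ℕ)
  | lt (x y : ℕ)

def RAMTest.Holds (s : RAMState) : RAMTest → Prop
  | eq x y => s.reg x = s.reg y
  | lt x y => s.reg x < s.reg y

/-- Programs: `assign x e` is `x := e`, and `store a y x` is `a[y] := x`. -/
inductive RAMProg where
  | skip
  | assign (x : ℕ) (e : Rhs)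
  | store (a y x : ℕ)
  | seq (p q : RAMProg)
  | ite (b : RAMTest) (p q : RAMProg)
  | while (b : RAMTest) (p : RAMProg)

def RAMState.setReg (s : RAMState) (x v : ℕ) : RAMState :=
  { s with reg := Function.update s.reg x v }

def RAMState.setArr (s : RAMState) (a i v : ℕ) : RAMState :=
  { s with arr := Function.update s.arr a (Function.update (s.arr a) i v) }

/-- `Exec W p s t s'`: started in state `s`, program `p` halts after exactly `t` steps in
state `s'`, and all the values computed on the way are at most `W`. -/
inductive Exec (W : ℕ) : RAMProg → RAMState → ℕ → RAMState → Prop where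
  | skip (s : RAMState) : Exec W .skip s 1 s
  | assign (s : RAMState) (x : ℕ) (e : Rhs) (h : e.eval s ≤ W) :
      Exec W (.assign x e) s 1 (s.setReg x (e.eval s))
  | store (s : RAMState) (a y x : ℕ) :
      Exec W (.store a y x) s 1 (s.setArr a (s.reg y) (s.reg x))
  | seq {p q : RAMProg} {s s' s'' : RAMState} {t t' : ℕ}
      (hp : Exec W p s t s') (hq : Exec W q s' t' s'') :
      Exec W (.seq p q) s (t + t') s''
  | ite_true {b : RAMTest} {p q : RAMProg} {s s' : RAMState} {t : ℕ}
      (hb : b.Holds s) (hp : Exec W p s t s') : Exec W (.ite b p q) s (t + 1) s'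
  | ite_false {b : RAMTest} {p q : RAMProg} {s s' : RAMState} {t : ℕ}
      (hb : ¬ b.Holds s) (hq : Exec W q s t s') : Exec W (.ite b p q) s (t + 1) s'
  | while_true {b : RAMTest} {p : RAMProg} {s s' s'' : RAMState} {t t' : ℕ}
      (hb : b.Holds s) (hp : Exec W p s t s') (hw : Exec W (.while b p) s' t' s'') :
      Exec W (.while b p) s (t + t' + 1) s''
  | while_false {b : RAMTest} {p : RAMProg} {s : RAMState} (hb : ¬ b.Holds s) :
      Exec W (.while b p) s 1 s

/-! ### Input and output -/

/-- Adjacency lists of a graph with vertices `0, …, n - 1`, stored one after the other: the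
neighbours of `v` are listed without repetition, in any order, in the cells
`off v, …, off (v + 1) - 1` of `nbr`. All the other cells are `0`. -/
structure IsAdjacencyList {n : ℕ} (G : SimpleGraph (Fin n)) (off nbr : ℕ → ℕ) : Prop where
  off_zero : off 0 = 0
  off_le : ∀ v < n, off v ≤ off (v + 1)
  nbr_bijOn : ∀ v : Fin n,
    Set.BijOn nbr (Set.Ico (off v) (off (v + 1))) (Fin.val '' G.neighborSet v)
  off_outside : ∀ i, n < i → off i = 0
  nbr_outside : ∀ i, off n ≤ i → nbr i = 0

/-- The initial state: the number of vertices in register `0`, the adjacency lists in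
arrays `0` and `1`, and `0` everywhere else. -/
def inputState (n : ℕ) (off nbr : ℕ → ℕ) : RAMState where
  reg x := if x = 0 then n else 0
  arr a := if a = 0 then off else if a = 1 then nbr else 0

/-- A `yes`-answer is a `1` in register `1`, together with the characteristic vector of `A` in
array `2`, for an MT-partition `(A, B)`. -/
def IsYesOutput {n : ℕ} (G : SimpleGraph (Fin n)) (s : RAMState) : Prop :=
  s.reg 1 = 1 ∧
    IsMTPartition G (Finset.univ.filter fun v : Fin n => s.arr 2 v = 1)
      (Finset.univ.filter fun v : Fin n => s.arr 2 v = 0)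

/-- A `no`-answer is a `0` in register `1`, together with the index of a forest obstruction in
register `2` and, in the first nine cells of array `2`, the vertices of an induced copy of it. -/
def IsNoOutput {n : ℕ} (G : SimpleGraph (Fin n)) (s : RAMState) : Prop :=
  s.reg 1 = 0 ∧
    ∃ k : Fin 11, s.reg 2 = k ∧
      ∃ f : forestObstruction k ↪g G, ∀ i : Fin 9, s.arr 2 i = f i

end MayaTupi

open MayaTupi

/-! In a forest, a set whose vertices each miss at most one other vertex of the set has at most two
vertices or is a path on three vertices (`IsDepth.isSmall`). So a forest is Maya-Tupi exactly when
such a small set meets every P₃. Forests are handled through a depth function in which every vertex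
has at most one shallower neighbour, its parent.

The structural core is `IsDepth.exists_forestObstruction`: if every small set misses some P₃ inside
a vertex set U, then U contains a member of the family. Take a P₃ `Q₁` in U whose top `x₁` is as
deep as possible. A P₃ in U avoiding `x₁` is disjoint from `Q₁`, and the only possible edge between
the two joins `x₁` to its parent. Repeat this in U without `x₁` to get `Q₂` with top `x₂`, then take
`Q₃` avoiding both tops. At most two edges run between the three paths. If they share an end, then
`x₁`, `x₂` and the parent of `x₂` form a P₃, and a third path that misses this small set has no edge
to `Q₂`. What remains is 3P₃ plus a matching of at most two edges, and a finite check up to the 48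
automorphisms of 3P₃ identifies it (`exists_shuffles`).

The algorithm is a search tree of depth three: find an unmarked P₃ and branch on which of its
vertices to mark, that is, to put in A. Each node costs O(n), since the adjacency lists of a tree
have fewer than 2n entries. A failed search has visited at most 1 + 3 + 9 + 27 nodes, so the paths
found occupy at most 120 stack cells. Every small set misses one of these paths (`wp_search`), so
the structural result applies with U the set of stacked vertices. An obstruction is then found by
trying all 9-tuples of stack cells, a constant number of O(n) tests. -/

namespace MayaTupi

/-! ### Elementary form of MT-partitions -/

section Basic

variable {V : Type*} (G : SimpleGraph V)

/-- `a - b - c` is a path on three vertices. -/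
def IsP3 (a b c : V) : Prop :=
  G.Adj b a ∧ G.Adj b c ∧ a ≠ c

/-- `A` has at most two vertices, or is the vertex set of a path on three vertices. -/
def IsSmall [DecidableEq V] (A : Finset V) : Prop :=
  A.card ≤ 2 ∨ ∃ a b c, IsP3 G a b c ∧ A = {a, b, c}

/-- Every vertex of `A` has at most one non-neighbour in `A`, and every vertex outside `A` has
at most one neighbour outside `A`. -/
def IsMTSet (A : Finset V) : Prop :=
  (∀ a ∈ A, ∀ b ∈ A, ∀ c ∈ A, b ≠ a → c ≠ a → b ≠ c → G.Adj a b ∨ G.Adj a c) ∧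
    ∀ a ∉ A, ∀ b ∉ A, ∀ c ∉ A, ¬ IsP3 G a b c

variable {G}

-- For `a` in `A`, the cardinality of `A` is the degree of `a` in the induced graph, plus one, plus
-- the number of non-neighbours of `a` in `A` other than `a`. The bound therefore allows one
-- non-neighbour.
open Classical in
theorem card_le_minDegree_induce_iff [Fintype V] (A : Finset V) :
    A.card ≤ (G.induce (A : Set V)).minDegree + 2 ↔
      ∀ a ∈ A, ∀ b ∈ A, ∀ c ∈ A, b ≠ a → c ≠ a → b ≠ c → G.Adj a b ∨ G.Adj a c := by
  have hcard (a : (A : Set V)) : A.card =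
      (G.induce (A : Set V)).degree a + 1 + (A.filter fun b => b ≠ a.1 ∧ ¬ G.Adj a b).card := by
    have h1 : (G.induce (A : Set V)).degree a = (A.filter fun b => G.Adj a b).card := by
      rw [← SimpleGraph.card_neighborFinset_eq_degree,
        ← Finset.card_map (Function.Embedding.subtype _)]
      congr 1
      ext b
      simp [and_comm]
    have h2 : A.card = (insert a.1 ((A.filter fun b => G.Adj a b) ∪
        (A.filter fun b => b ≠ a ∧ ¬ G.Adj a b))).card := by
      congr 1
      ext b
      have := a.2
      simp only [SetLike.mem_coe] at this
      by_cases hb : b = a.1 <;> by_cases hab : G.Adj a b <;> simp_all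
    rw [h2, Finset.card_insert_of_notMem (by simp), Finset.card_union_of_disjoint, h1]
    · ring
    · rw [Finset.disjoint_left]
      simp +contextual
  constructor
  · intro h a ha b hb c hc hba hca hbc
    by_contra! hcon
    have h1 := hcard ⟨a, ha⟩
    have h2 := (G.induce (A : Set V)).minDegree_le_degree ⟨a, ha⟩
    have h3 : 1 < (A.filter fun b => b ≠ a ∧ ¬ G.Adj a b).card :=
      Finset.one_lt_card.2 ⟨b, by simp [*], c, by simp [*], hbc⟩
    simp only at h1
    omega
  · intro h
    -- The minimum degree of the empty graph is 0 by convention, which suffices when `A` is empty.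
    rcases A.eq_empty_or_nonempty with rfl | ⟨a, ha⟩
    · simp
    have : Nonempty (A : Set V) := ⟨⟨a, ha⟩⟩
    obtain ⟨v, hv⟩ := (G.induce (A : Set V)).exists_minimal_degree_vertex
    have h1 := hcard v
    have h3 : (A.filter fun b => b ≠ v.1 ∧ ¬ G.Adj v b).card ≤ 1 := by
      by_contra! hlt
      obtain ⟨b, hb, c, hc, hbc⟩ := Finset.one_lt_card.1 hlt
      simp only [Finset.mem_filter] at hb hc
      have := h v v.2 b hb.1 c hc.1 hb.2.1 hc.2.1 hbc
      tauto
    omega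

open Classical in
theorem maxDegree_induce_le_one_iff [Fintype V] (B : Finset V) :
    (G.induce (B : Set V)).maxDegree ≤ 1 ↔
      ∀ a ∈ B, ∀ b ∈ B, ∀ c ∈ B, ¬ IsP3 G a b c := by
  constructor
  · rintro h a ha b hb c hc ⟨h1, h2, h3⟩
    have h4 := ((G.induce (B : Set V)).degree_le_maxDegree ⟨b, hb⟩).trans h
    rw [← SimpleGraph.card_neighborFinset_eq_degree, Finset.card_le_one] at h4
    have := h4 ⟨a, ha⟩ (by simpa using h1) ⟨c, hc⟩ (by simpa using h2)
    simp_all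
  · intro h
    refine SimpleGraph.maxDegree_le_of_forall_degree_le _ _ fun v => ?_
    rw [← SimpleGraph.card_neighborFinset_eq_degree, Finset.card_le_one]
    intro a ha c hc
    by_contra hne
    refine h a a.2 v v.2 c c.2 ⟨?_, ?_, ?_⟩
    · simpa using ha
    · simpa using hc
    · exact fun h => hne (Subtype.ext h)

theorem isMTPartition_iff [Fintype V] {A B : Finset V} :
    IsMTPartition G A B ↔ IsCompl A B ∧ IsMTSet G A := by
  classical
  rw [IsMTPartition, card_le_minDegree_induce_iff, maxDegree_induce_le_one_iff, IsMTSet]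
  refine and_congr_right fun h => ?_
  have hB : ∀ v, v ∈ B ↔ v ∉ A := by
    rw [← h.compl_eq]
    simp
  simp only [hB]

theorem isMayaTupi_iff [Fintype V] : IsMayaTupi G ↔ ∃ A, IsMTSet G A := by
  classical
  constructor
  · rintro ⟨A, B, h⟩
    exact ⟨A, (isMTPartition_iff.1 h).2⟩
  · rintro ⟨A, h⟩
    exact ⟨A, Aᶜ, isMTPartition_iff.2 ⟨isCompl_compl, h⟩⟩

/-- Holds in every graph; it certifies the sets found by the search. Only forests need the converse,
`IsDepth.isSmall`. -/
theorem IsSmall.adj_or_adj [DecidableEq V] {A : Finset V} (hA : IsSmall G A) :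
    ∀ a ∈ A, ∀ b ∈ A, ∀ c ∈ A, b ≠ a → c ≠ a → b ≠ c → G.Adj a b ∨ G.Adj a c := by
  intro a ha b hb c hc hba hca hbc
  rcases hA with hA | ⟨x, y, z, ⟨h1, h2, h3⟩, rfl⟩
  · have : ({a, b, c} : Finset V).card ≤ A.card := by
      apply Finset.card_le_card
      simp [Finset.insert_subset_iff, *]
    rw [Finset.card_eq_three.2 ⟨a, b, c, hba.symm, hca.symm, hbc, rfl⟩] at this
    omega
  · have h1' := h1.symm
    have h2' := h2.symm
    simp only [Finset.mem_insert, Finset.mem_singleton] at ha hb hc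
    rcases ha with rfl | rfl | rfl <;> rcases hb with rfl | rfl | rfl <;>
      rcases hc with rfl | rfl | rfl <;> simp_all

end Basic

/-! ### Rooted forests -/

section Depth

variable {V : Type*} {G : SimpleGraph V} {d : V → ℕ}

/-- `d` is a depth function: the ends of an edge have different depths, and every vertex has at
most one neighbour of smaller depth. -/
structure IsDepth (G : SimpleGraph V) (d : V → ℕ) : Prop where
  ne : ∀ u v, G.Adj u v → d u ≠ d v
  unique : ∀ v u w, G.Adj v u → G.Adj v w → d u < d v → d w < d v → u = w

/-- A neighbour of `v` closer to the root must be the penultimate vertex of the unique path from the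
root to `v`, so there is only one. -/
theorem isDepth_dist (hG : G.IsTree) (r : V) : IsDepth G (G.dist r) where
  ne _ _ h := hG.dist_ne_of_adj r h
  unique v u w hu hw hdu hdw := by
    obtain ⟨p, hp, hp'⟩ := (hG.connected r v).exists_path_of_dist
    have key : ∀ u, G.Adj v u → G.dist r u < G.dist r v → u = p.penultimate := by
      intro u hu hdu
      obtain ⟨q, hq, hq'⟩ := (hG.connected r u).exists_path_of_dist
      refine hG.isAcyclic.eq_penultimate_of_adj_end hp hu ?_
      refine hG.isAcyclic.mem_support_of_ne_mem_support_of_adj_of_isPath hp hq hu fun hv => ?_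
      have := hG.isAcyclic.path_concat hp hq hu hv
      have := congrArg SimpleGraph.Walk.length this
      rw [SimpleGraph.Walk.length_concat] at this
      omega
    rw [key u hu hdu, key w hw hdw]

/-- A deepest vertex of a cycle would have two distinct shallower neighbours, namely its two
neighbours on the cycle. -/
theorem IsDepth.isAcyclic (hd : IsDepth G d) : G.IsAcyclic := by
  classical
  intro v w hw
  obtain ⟨x, hx, hmax⟩ := w.support.toFinset.exists_max_image d ⟨v, by simp⟩
  rw [List.mem_toFinset] at hx
  have hc := hw.rotate hx
  have hlt : ∀ y ∈ (w.rotate x hx).support, G.Adj x y → d y < d x := by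
    intro y hy hxy
    have h1 := hmax y (by simpa using (SimpleGraph.Walk.mem_support_rotate_iff w x hx).1 hy)
    have := hd.ne _ _ hxy
    omega
  have hn := hc.not_nil
  refine hc.snd_ne_penultimate (hd.unique x _ _ (SimpleGraph.Walk.adj_snd hn)
    (SimpleGraph.Walk.adj_penultimate hn).symm (hlt _ ?_ ?_) (hlt _ ?_ ?_))
  · exact SimpleGraph.Walk.getVert_mem_support _ _
  · exact SimpleGraph.Walk.adj_snd hn
  · exact SimpleGraph.Walk.getVert_mem_support _ _
  · exact (SimpleGraph.Walk.adj_penultimate hn).symm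

theorem IsDepth.not_adj_of_isP3 (hd : IsDepth G d) {a b c : V} (h : IsP3 G a b c) :
    ¬ G.Adj a c := by
  obtain ⟨h1, h2, h3⟩ := h
  intro h4
  have := hd.ne _ _ h1
  have := hd.ne _ _ h2
  have := hd.ne _ _ h4
  have := hd.unique a b c h1.symm h4
  have := hd.unique b a c h1 h2
  have := hd.unique c a b h4.symm h2.symm
  have := h1.ne
  have := h2.ne
  grind

variable [DecidableEq V]

/-- A deepest vertex `v` of `A` has at most one neighbour in `A`, its parent, and at most one
non-neighbour. Hence `A` has at most three vertices. If there are three, the non-neighbour `y` of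
`v` has used up its only exception and is adjacent to the parent `x`. -/
theorem IsDepth.isSmall (hd : IsDepth G d) {A : Finset V}
    (hA : ∀ a ∈ A, ∀ b ∈ A, ∀ c ∈ A, b ≠ a → c ≠ a → b ≠ c → G.Adj a b ∨ G.Adj a c) :
    IsSmall G A := by
  by_contra hcon
  rw [IsSmall, not_or, not_le] at hcon
  obtain ⟨h3, hP⟩ := hcon
  obtain ⟨v, hv, hmax⟩ := A.exists_max_image d (Finset.card_pos.1 (by omega))
  have key : ∀ x ∈ A, ∀ y ∈ A, G.Adj v x → G.Adj v y → x = y := by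
    intro x hx y hy hvx hvy
    have := hmax x hx
    have := hmax y hy
    have := hd.ne _ _ hvx
    have := hd.ne _ _ hvy
    exact hd.unique v x y hvx hvy (by omega) (by omega)
  have hcard : 1 < (A.erase v).card := by
    rw [Finset.card_erase_of_mem hv]
    omega
  obtain ⟨x, hx, y, hy, hxy⟩ := Finset.one_lt_card.1 hcard
  rw [Finset.mem_erase] at hx hy
  wlog hvx : G.Adj v x generalizing x y
  · refine this y hy x hx hxy.symm ?_
    have := hA v hv x hx.2 y hy.2 hx.1 hy.1 hxy
    tauto
  have hvy : ¬ G.Adj v y := fun h => hxy (key x hx.2 y hy.2 hvx h)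
  have hyx : G.Adj y x := by
    have := hA y hy.2 v hv x hx.2 hy.1.symm hxy hx.1.symm
    rw [G.adj_comm y v] at this
    tauto
  refine hP ⟨v, x, y, ⟨hvx.symm, hyx.symm, hy.1.symm⟩, ?_⟩
  ext z
  simp only [Finset.mem_insert, Finset.mem_singleton]
  refine ⟨fun hz => ?_, by rintro (rfl | rfl | rfl) <;> simp_all⟩
  by_contra! hne
  have h1 := hA v hv z hz y hy.2 hne.1 hy.1 hne.2.2
  have h2 : G.Adj v z := by tauto
  exact hne.2.1 (key z hz x hx.2 h2 hvx)

/-- The vertex set of a path on three vertices. -/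
def IsP3Set (G : SimpleGraph V) (Q : Finset V) : Prop :=
  ∃ a b c, IsP3 G a b c ∧ Q = {a, b, c}

/-- The top is the center or one of the ends; the center cannot be the deepest of the three, since
both ends would be its parent. All other vertices have their parent inside the path. -/
theorem IsDepth.exists_top (hd : IsDepth G d) {Q : Finset V} (hQ : IsP3Set G Q) :
    ∃ t ∈ Q, ∀ y ∈ Q, y = t ∨ d t < d y ∧ ∃ z ∈ Q, G.Adj y z ∧ d z < d y := by
  obtain ⟨a, b, c, h, rfl⟩ := hQ
  obtain ⟨h1, h2, h3⟩ := h
  have h4 := hd.ne _ _ h1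
  have h5 := hd.ne _ _ h2
  have h6 := hd.unique b a c h1 h2
  have h1' := h1.symm
  have h2' := h2.symm
  simp only [Finset.mem_insert, Finset.mem_singleton, exists_eq_or_imp, forall_eq_or_imp,
    exists_eq_left, forall_eq]
  rcases h4.lt_or_gt with h4 | h4 <;> rcases h5.lt_or_gt with h5 | h5
  · right; left
    simp [*]
  · right; right
    exact ⟨.inr ⟨by omega, by simp [*]⟩, by simp [*], by simp⟩
  · left
    exact ⟨by simp, by simp [*], .inr ⟨by omega, by simp [*]⟩⟩
  · exact absurd (h6 h4 h5) h3

/-- Here `x` is the top of `Q`, chosen as deep as possible. Any other path `R` has its top no deeper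
than `x`, so it can meet or touch the part of the forest below `x` only through `x`. -/
theorem IsDepth.exists_lowest [Finite V] (hd : IsDepth G d) (S : Set V)
    (hS : ∃ Q, IsP3Set G Q ∧ ↑Q ⊆ S) :
    ∃ Q, IsP3Set G Q ∧ ↑Q ⊆ S ∧ ∃ x ∈ Q, ∀ R, IsP3Set G R → ↑R ⊆ S → x ∉ R →
      Disjoint Q R ∧ ∀ y ∈ Q, ∀ z ∈ R, G.Adj y z → y = x ∧ d z < d x := by
  classical
  let T : Set (Finset V × V) := {p | IsP3Set G p.1 ∧ ↑p.1 ⊆ S ∧ p.2 ∈ p.1 ∧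
    ∀ y ∈ p.1, y = p.2 ∨ d p.2 < d y ∧ ∃ z ∈ p.1, G.Adj y z ∧ d z < d y}
  have hT : T.Nonempty := by
    obtain ⟨Q, hQ, hQS⟩ := hS
    obtain ⟨t, ht, h⟩ := hd.exists_top hQ
    exact ⟨(Q, t), hQ, hQS, ht, h⟩
  obtain ⟨⟨Q, x⟩, ⟨hQ, hQS, hx, htop⟩, hmax⟩ :=
    Set.exists_max_image T (fun p => d p.2) (Set.toFinite T) hT
  refine ⟨Q, hQ, hQS, x, hx, fun R hR hRS hxR => ?_⟩
  obtain ⟨t, ht, htopR⟩ := hd.exists_top hR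
  have htx : d t ≤ d x := hmax (R, t) ⟨hR, hRS, ht, htopR⟩
  simp only at htop
  have hdisj : Disjoint Q R := by
    by_contra hcon
    rw [Finset.disjoint_iff_inter_eq_empty, ← Finset.not_nonempty_iff_eq_empty, not_not] at hcon
    -- A shallowest common vertex is the top of neither path, so its unique parent lies in both, a
    -- contradiction.
    obtain ⟨y, hy, hmin⟩ := (Q ∩ R).exists_min_image d hcon
    rw [Finset.mem_inter] at hy
    have hyx : y ≠ x := by
      rintro rfl
      exact hxR hy.2
    obtain ⟨h1, z, hz, hyz, hzd⟩ := (htop y hy.1).resolve_left hyx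
    have hyt : y ≠ t := by
      rintro rfl
      omega
    obtain ⟨-, z', hz', hyz', hzd'⟩ := (htopR y hy.2).resolve_left hyt
    obtain rfl := hd.unique y z z' hyz hyz' hzd hzd'
    have := hmin z (Finset.mem_inter.2 ⟨hz, hz'⟩)
    omega
  refine ⟨hdisj, fun y hy z hz hyz => ?_⟩
  rw [Finset.disjoint_left] at hdisj
  rcases (hd.ne _ _ hyz).lt_or_gt with h | h
  -- If `z` is the deeper end, it lies below the top of `R`, so its parent `y` would belong to `R`.
  · exfalso
    have hxy : d x ≤ d y := by
      rcases htop y hy with rfl | h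
      · rfl
      · omega
    have hzt : z ≠ t := by
      rintro rfl
      omega
    obtain ⟨-, w, hw, hzw, hwd⟩ := (htopR z hz).resolve_left hzt
    obtain rfl := hd.unique z y w hyz.symm hzw h hwd
    exact hdisj hy hw
  · by_cases hyx : y = x
    · subst hyx
      exact ⟨rfl, h⟩
    · exfalso
      obtain ⟨-, w, hw, hyw, hwd⟩ := (htop y hy).resolve_left hyx
      obtain rfl := hd.unique y z w hyz hyw h hwd
      exact hdisj hw hz

end Depth

/-! ### Recognizing the forest obstructions -/

/-- The automorphisms of `3P₃`: `m / 8` says how to permute the three paths, and the digits of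
`m % 8` in base two say which of them to reverse. -/
def shuffle (m : Fin 48) (i : Fin 9) : Fin 9 :=
  let q := i.val / 3
  let r := i.val % 3
  let π := [[0, 1, 2], [0, 2, 1], [1, 0, 2], [1, 2, 0], [2, 0, 1], [2, 1, 0]].getD (m.val / 8) []
  Fin.ofNat 9 (3 * π.getD q 0 + if (m.val % 8).testBit q then 2 - r else r)

/-- The edge from `i` to `j` occurs in `l` in one of its two orientations. -/
def hasEdge (l : List (Fin 9 × Fin 9)) (i j : Fin 9) : Bool :=
  l.any fun e => (e.1 == i && e.2 == j) || (e.1 == j && e.2 == i)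

theorem hasEdge_iff {l : List (Fin 9 × Fin 9)} {i j : Fin 9} :
    hasEdge l i j = true ↔ (i, j) ∈ l ∨ (j, i) ∈ l := by
  simp only [hasEdge, List.any_eq_true, Bool.or_eq_true, Bool.and_eq_true, beq_iff_eq, Prod.exists]
  constructor
  · rintro ⟨a, b, h, ⟨rfl, rfl⟩ | ⟨rfl, rfl⟩⟩ <;> simp [h]
  · rintro (h | h)
    · exact ⟨_, _, h, by simp⟩
    · exact ⟨_, _, h, by simp⟩

/-- A possible edge that leaves the first path of `3P₃`. -/
def firstCross : Option (Fin 3 × Fin 6) → List (Fin 9 × Fin 9)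
  | none => []
  | some (i, j) => [(i.castLE (by omega), (j.natAdd 3).cast (by omega))]

/-- A possible edge between the second and the third path of `3P₃`. -/
def secondCross : Option (Fin 3 × Fin 3) → List (Fin 9 × Fin 9)
  | none => []
  | some (i, j) => [((i.natAdd 3).castLE (by omega), (j.natAdd 6).cast (by omega))]

theorem shuffle_injective (m : Fin 48) : Function.Injective (shuffle m) := by
  have : ∀ m i j, shuffle m i = shuffle m j → i = j := by decide +kernel
  exact fun i j h => this m i j h

theorem hasEdge_edges3P3_shuffle : ∀ m i j,
    hasEdge edges3P3 (shuffle m i) (shuffle m j) = hasEdge edges3P3 i j := by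
  decide +kernel

/-- `shuffle m` maps the edges in `l` to those in `l'`. -/
def shuffles (m : Fin 48) (l l' : List (Fin 9 × Fin 9)) : Bool :=
  (l.all fun e => hasEdge l' (shuffle m e.1) (shuffle m e.2)) &&
    l'.all fun e => l.any fun e' => hasEdge [e] (shuffle m e'.1) (shuffle m e'.2)

/-- The two inclusions in `shuffles` speak only of listed edges; injectivity of the permutation
pulls an edge of `l'` back to the same pair of vertices. -/
theorem hasEdge_of_shuffles {m : Fin 48} {l l' : List (Fin 9 × Fin 9)}
    (h : shuffles m l l' = true) (i j : Fin 9) :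
    hasEdge l' (shuffle m i) (shuffle m j) = hasEdge l i j := by
  simp only [shuffles, Bool.and_eq_true, List.all_eq_true, List.any_eq_true, Prod.forall,
    Prod.exists] at h
  obtain ⟨h1, h2⟩ := h
  rw [Bool.eq_iff_iff]
  constructor
  · intro hij
    obtain ⟨a, b, hab, he⟩ : ∃ a b, (a, b) ∈ l' ∧
        ((a, b) = (shuffle m i, shuffle m j) ∨ (b, a) = (shuffle m i, shuffle m j)) := by
      rcases hasEdge_iff.1 hij with h | h
      · exact ⟨_, _, h, .inl rfl⟩
      · exact ⟨_, _, h, .inr rfl⟩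
    obtain ⟨x, y, hxy, h3⟩ := h2 a b hab
    have hinj := shuffle_injective m
    rw [hasEdge_iff] at h3 ⊢
    simp only [List.mem_singleton, Prod.mk.injEq] at h3 he
    obtain ⟨rfl, rfl⟩ | ⟨rfl, rfl⟩ := he
    · obtain ⟨h4, h5⟩ | ⟨h4, h5⟩ := h3
      · rw [← hinj h4, ← hinj h5]
        exact .inl hxy
      · rw [← hinj h4, ← hinj h5]
        exact .inr hxy
    · obtain ⟨h4, h5⟩ | ⟨h4, h5⟩ := h3
      · rw [← hinj h4, ← hinj h5]
        exact .inr hxy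
      · rw [← hinj h4, ← hinj h5]
        exact .inl hxy
  · intro hij
    rw [hasEdge_iff] at hij
    rcases hij with h | h
    · exact h1 _ _ h
    · rw [hasEdge_iff, or_comm, ← hasEdge_iff]
      exact h1 _ _ h

/-- The hypothesis makes the added edges a matching: their ends in the first path cannot clash, as
the second edge avoids that path. There are 19 · 10 choices before this restriction, and each
admissible one is an automorphic image of one of the eleven lists. -/
theorem exists_shuffles : ∀ (o₁ : Option (Fin 3 × Fin 6)) (o₂ : Option (Fin 3 × Fin 3)),
    (∀ e ∈ firstCross o₁, ∀ e' ∈ secondCross o₂, e.2 ≠ e'.1 ∧ e.2 ≠ e'.2) →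
      ∃ k m, shuffles m (addedEdges k) (firstCross o₁ ++ secondCross o₂) = true := by
  decide +kernel

theorem forestObstruction_adj {k : Fin 11} {i j : Fin 9} :
    (forestObstruction k).Adj i j ↔ hasEdge (edges3P3 ++ addedEdges k) i j = true := by
  rw [forestObstruction, SimpleGraph.fromRel_adj, hasEdge_iff, and_iff_right_iff_imp]
  have : ∀ k i, (i, i) ∉ edges3P3 ++ addedEdges k := by decide +kernel
  rintro h rfl
  exact this k i (by tauto)

section Copy

variable {V : Type*} {G : SimpleGraph V} {d : V → ℕ}

/-- A copy of `3P₃` with at most two further edges, at most one that leaves the first path, and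
at most one between the other two paths, and these two edges have no common end. -/
theorem IsDepth.exists_embedding (hd : IsDepth G d) {f : Fin 9 → V} (hf : Function.Injective f)
    (hP : IsP3 G (f 0) (f 1) (f 2) ∧ IsP3 G (f 3) (f 4) (f 5) ∧ IsP3 G (f 6) (f 7) (f 8))
    (h₁ : ∀ i j i' j' : Fin 9, i < 3 → 3 ≤ j → i' < 3 → 3 ≤ j' → G.Adj (f i) (f j) →
      G.Adj (f i') (f j') → i = i' ∧ j = j')
    (h₂ : ∀ i j i' j' : Fin 9, 3 ≤ i → i < 6 → 6 ≤ j → 3 ≤ i' → i' < 6 → 6 ≤ j' →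
      G.Adj (f i) (f j) → G.Adj (f i') (f j') → i = i' ∧ j = j')
    (h₃ : ∀ i j i' j' : Fin 9, i < 3 → 3 ≤ j → 3 ≤ i' → i' < 6 → 6 ≤ j' → G.Adj (f i) (f j) →
      G.Adj (f i') (f j') → j ≠ i' ∧ j ≠ j') :
    ∃ k, ∃ e : forestObstruction k ↪g G, ∀ i, ∃ j, e i = f j := by
  obtain ⟨o₁, ho₁⟩ : ∃ o, ∀ i j : Fin 9, i < 3 → 3 ≤ j →
      (G.Adj (f i) (f j) ↔ (i, j) ∈ firstCross o) := by
    by_cases h : ∃ i j : Fin 9, i < 3 ∧ 3 ≤ j ∧ G.Adj (f i) (f j)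
    · obtain ⟨i, j, hi, hj, hij⟩ := h
      refine ⟨some (⟨i, hi⟩, ⟨j - 3, by omega⟩), fun i' j' hi' hj' => ?_⟩
      have : firstCross (some (⟨i, hi⟩, ⟨j - 3, by omega⟩)) = [(i, j)] := by
        simp only [firstCross, List.cons.injEq, Prod.mk.injEq, and_true, Fin.ext_iff]
        simp
        omega
      rw [this, List.mem_singleton, Prod.mk.injEq]
      refine ⟨fun h => ?_, ?_⟩
      · exact h₁ _ _ _ _ hi' hj' hi hj h hij
      · rintro ⟨rfl, rfl⟩
        exact hij
    · push Not at h
      exact ⟨none, fun i j hi hj => by simp [firstCross, h i j hi hj]⟩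
  obtain ⟨o₂, ho₂⟩ : ∃ o, ∀ i j : Fin 9, 3 ≤ i → i < 6 → 6 ≤ j →
      (G.Adj (f i) (f j) ↔ (i, j) ∈ secondCross o) := by
    by_cases h : ∃ i j : Fin 9, 3 ≤ i ∧ i < 6 ∧ 6 ≤ j ∧ G.Adj (f i) (f j)
    · obtain ⟨i, j, hi, hi6, hj, hij⟩ := h
      refine ⟨some (⟨i - 3, by omega⟩, ⟨j - 6, by omega⟩), fun i' j' hi' hi6' hj' => ?_⟩
      have : secondCross (some (⟨i - 3, by omega⟩, ⟨j - 6, by omega⟩)) = [(i, j)] := by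
        simp only [secondCross, List.cons.injEq, Prod.mk.injEq, and_true, Fin.ext_iff]
        simp
        omega
      rw [this, List.mem_singleton, Prod.mk.injEq]
      refine ⟨fun h => ?_, ?_⟩
      · exact h₂ _ _ _ _ hi' hi6' hj' hi hi6 hj h hij
      · rintro ⟨rfl, rfl⟩
        exact hij
    · push Not at h
      exact ⟨none, fun i j hi hi6 hj => by simp [secondCross, h i j hi hi6 hj]⟩
  have hmem₁ : ∀ o, ∀ e ∈ firstCross o, e.1 < 3 ∧ 3 ≤ e.2 := by decide
  have hmem₂ : ∀ o, ∀ e ∈ secondCross o, 3 ≤ e.1 ∧ e.1 < 6 ∧ 6 ≤ e.2 := by decide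
  obtain ⟨k, m, hkm⟩ := exists_shuffles o₁ o₂ (by
    intro e he e' he'
    obtain ⟨a1, a2⟩ := hmem₁ _ _ he
    obtain ⟨b1, b2, b3⟩ := hmem₂ _ _ he'
    exact h₃ e.1 e.2 e'.1 e'.2 a1 a2 b1 b2 b3 ((ho₁ _ _ a1 a2).2 he) ((ho₂ _ _ b1 b2 b3).2 he'))
  have hlt : ∀ i j : Fin 9, i < j → (G.Adj (f i) (f j) ↔
      hasEdge (edges3P3 ++ (firstCross o₁ ++ secondCross o₂)) i j = true) := by
    intro i j hij
    rw [hasEdge_iff]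
    simp only [List.mem_append]
    have hn₁ : (j, i) ∉ firstCross o₁ := fun h => by
      have := hmem₁ _ _ h
      simp only at this
      omega
    have hn₂ : (j, i) ∉ secondCross o₂ := fun h => by
      have := hmem₂ _ _ h
      simp only at this
      omega
    by_cases hc₁ : i < 3 ∧ 3 ≤ j
    · have h1 : (i, j) ∉ secondCross o₂ := fun h => by
        have := hmem₂ _ _ h
        simp only at this
        omega
      have h2 : ∀ i j : Fin 9, i < 3 → 3 ≤ j → (i, j) ∉ edges3P3 ∧ (j, i) ∉ edges3P3 := by
        decide
      simp [ho₁ i j hc₁.1 hc₁.2, h1, h2 i j hc₁.1 hc₁.2, hn₁, hn₂]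
    · have h1 : (i, j) ∉ firstCross o₁ := fun h => hc₁ (hmem₁ _ _ h)
      by_cases hc₂ : 3 ≤ i ∧ i < 6 ∧ 6 ≤ j
      · have h2 : ∀ i j : Fin 9, 3 ≤ i → i < 6 → 6 ≤ j →
            (i, j) ∉ edges3P3 ∧ (j, i) ∉ edges3P3 := by
          decide
        simp [ho₂ i j hc₂.1 hc₂.2.1 hc₂.2.2, h1, h2 i j hc₂.1 hc₂.2.1 hc₂.2.2, hn₁, hn₂]
      · have h2 : (i, j) ∉ secondCross o₂ := fun h => hc₂ (hmem₂ _ _ h)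
        -- The remaining pairs lie inside one of the three paths. The two ends of a path are not
        -- adjacent because a forest has no triangle.
        have h3 : ∀ i j : Fin 9, i < j → ¬ (i < 3 ∧ 3 ≤ j) → ¬ (3 ≤ i ∧ i < 6 ∧ 6 ≤ j) →
            (i, j) ∈ [(0, 1), (1, 2), (0, 2), (3, 4), (4, 5), (3, 5), (6, 7), (7, 8), (6, 8)] := by
          decide
        have h4 := h3 i j hij hc₁ hc₂
        obtain ⟨p1, p2, p3⟩ := hP
        have q1 := hd.not_adj_of_isP3 p1
        have q2 := hd.not_adj_of_isP3 p2
        have q3 := hd.not_adj_of_isP3 p3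
        obtain ⟨a1, b1, -⟩ := p1
        obtain ⟨a2, b2, -⟩ := p2
        obtain ⟨a3, b3, -⟩ := p3
        simp only [hn₁, hn₂, h1, h2, or_false]
        simp only [List.mem_cons, Prod.mk.injEq, List.not_mem_nil, or_false] at h4
        rcases h4 with ⟨rfl, rfl⟩ | ⟨rfl, rfl⟩ | ⟨rfl, rfl⟩ | ⟨rfl, rfl⟩ | ⟨rfl, rfl⟩ |
          ⟨rfl, rfl⟩ | ⟨rfl, rfl⟩ | ⟨rfl, rfl⟩ | ⟨rfl, rfl⟩
        · exact iff_of_true a1.symm (by decide)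
        · exact iff_of_true b1 (by decide)
        · exact iff_of_false q1 (by decide)
        · exact iff_of_true a2.symm (by decide)
        · exact iff_of_true b2 (by decide)
        · exact iff_of_false q2 (by decide)
        · exact iff_of_true a3.symm (by decide)
        · exact iff_of_true b3 (by decide)
        · exact iff_of_false q3 (by decide)
  have hadj : ∀ i j : Fin 9, G.Adj (f i) (f j) ↔
      hasEdge (edges3P3 ++ (firstCross o₁ ++ secondCross o₂)) i j = true := by
    intro i j
    rcases lt_trichotomy i j with h | rfl | h
    · exact hlt i j h
    · refine iff_of_false (G.irrefl) fun h => ?_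
      rw [hasEdge_iff, or_self, List.mem_append, List.mem_append] at h
      rcases h with h | h | h
      · have : ∀ i : Fin 9, (i, i) ∉ edges3P3 := by decide
        exact this i h
      · have := hmem₁ _ _ h
        simp only at this
        omega
      · have := hmem₂ _ _ h
        simp only at this
        omega
    · rw [G.adj_comm, hlt j i h, hasEdge_iff, hasEdge_iff, or_comm]
  refine ⟨k, ⟨⟨fun i => f (shuffle m i), hf.comp (shuffle_injective m)⟩, ?_⟩, fun i => ⟨_, rfl⟩⟩
  intro i j
  rw [forestObstruction_adj]
  simp only [Function.Embedding.coeFn_mk]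
  have happ : ∀ (l l' : List (Fin 9 × Fin 9)) i j,
      hasEdge (l ++ l') i j = (hasEdge l i j || hasEdge l' i j) := by
    intro l l' i j
    simp [hasEdge]
  rw [hadj, happ edges3P3, happ edges3P3, hasEdge_edges3P3_shuffle, hasEdge_of_shuffles hkm]

variable [DecidableEq V]

/-- Every edge leaving `Q₁` towards the other paths goes from `x₁` to its parent, and every edge
from `Q₂` to `Q₃` from `x₂` to its parent. Uniqueness of parents leaves at most one edge of each
kind. -/
theorem IsDepth.exists_embedding_of_disjoint (hd : IsDepth G d) {U : Set V}
    {Q₁ Q₂ Q₃ : Finset V} (hQ₁ : IsP3Set G Q₁) (hQ₂ : IsP3Set G Q₂) (hQ₃ : IsP3Set G Q₃)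
    (h₁₂ : Disjoint Q₁ Q₂) (h₁₃ : Disjoint Q₁ Q₃) (h₂₃ : Disjoint Q₂ Q₃)
    (hU₁ : ↑Q₁ ⊆ U) (hU₂ : ↑Q₂ ⊆ U) (hU₃ : ↑Q₃ ⊆ U) {x₁ x₂ : V}
    (hx₁ : ∀ y ∈ Q₁, ∀ z ∈ Q₂ ∪ Q₃, G.Adj y z → y = x₁ ∧ d z < d x₁)
    (hx₂ : ∀ y ∈ Q₂, ∀ z ∈ Q₃, G.Adj y z → y = x₂ ∧ d z < d x₂)
    (h : ∀ p₁ ∈ Q₂ ∪ Q₃, ∀ p₂ ∈ Q₃, x₂ ∈ Q₂ → G.Adj x₁ p₁ → G.Adj x₂ p₂ → p₁ ≠ x₂ ∧ p₁ ≠ p₂) :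
    ∃ k, ∃ e : forestObstruction k ↪g G, ∀ i, e i ∈ U := by
  obtain ⟨a₁, b₁, c₁, hP₁, rfl⟩ := hQ₁
  obtain ⟨a₂, b₂, c₂, hP₂, rfl⟩ := hQ₂
  obtain ⟨a₃, b₃, c₃, hP₃, rfl⟩ := hQ₃
  let f : Fin 9 → V := ![a₁, b₁, c₁, a₂, b₂, c₂, a₃, b₃, c₃]
  have hm₁ : ∀ i : Fin 9, i < 3 → f i ∈ ({a₁, b₁, c₁} : Finset V) := by
    intro i hi
    obtain rfl | rfl | rfl : i = 0 ∨ i = 1 ∨ i = 2 := by omega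
    all_goals simp [f]
  have hm₂ : ∀ i : Fin 9, 3 ≤ i → i < 6 → f i ∈ ({a₂, b₂, c₂} : Finset V) := by
    intro i hi hi'
    obtain rfl | rfl | rfl : i = 3 ∨ i = 4 ∨ i = 5 := by omega
    all_goals simp [f]
  have hm₃ : ∀ i : Fin 9, 6 ≤ i → f i ∈ ({a₃, b₃, c₃} : Finset V) := by
    intro i hi
    obtain rfl | rfl | rfl : i = 6 ∨ i = 7 ∨ i = 8 := by omega
    all_goals simp [f]
  have hm₂₃ : ∀ i : Fin 9, 3 ≤ i → f i ∈ ({a₂, b₂, c₂} ∪ {a₃, b₃, c₃} : Finset V) := by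
    intro i hi
    rw [Finset.mem_union]
    by_cases h : i < 6
    · exact .inl (hm₂ i hi h)
    · exact .inr (hm₃ i (by omega))
  have hinj : Function.Injective f := by
    have hlt : ∀ i j : Fin 9, i < j → f i ≠ f j := by
      intro i j hij heq
      rw [Finset.disjoint_left] at h₁₂ h₁₃ h₂₃
      by_cases hi3 : i < 3
      · by_cases hj3 : 3 ≤ j
        · have h1 := hm₁ i hi3
          have h2 := hm₂₃ j hj3
          rw [heq] at h1
          rw [Finset.mem_union] at h2
          exact h2.elim (h₁₂ h1) (h₁₃ h1)
        · obtain ⟨rfl, rfl⟩ | ⟨rfl, rfl⟩ | ⟨rfl, rfl⟩ :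
            i = 0 ∧ j = 1 ∨ i = 0 ∧ j = 2 ∨ i = 1 ∧ j = 2 := by omega
          · exact hP₁.1.ne heq.symm
          · exact hP₁.2.2 heq
          · exact hP₁.2.1.ne heq
      · by_cases hi6 : i < 6
        · by_cases hj6 : 6 ≤ j
          · have h1 := hm₂ i (by omega) hi6
            rw [heq] at h1
            exact h₂₃ h1 (hm₃ j hj6)
          · obtain ⟨rfl, rfl⟩ | ⟨rfl, rfl⟩ | ⟨rfl, rfl⟩ :
              i = 3 ∧ j = 4 ∨ i = 3 ∧ j = 5 ∨ i = 4 ∧ j = 5 := by omega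
            · exact hP₂.1.ne heq.symm
            · exact hP₂.2.2 heq
            · exact hP₂.2.1.ne heq
        · obtain ⟨rfl, rfl⟩ | ⟨rfl, rfl⟩ | ⟨rfl, rfl⟩ :
            i = 6 ∧ j = 7 ∨ i = 6 ∧ j = 8 ∨ i = 7 ∧ j = 8 := by omega
          · exact hP₃.1.ne heq.symm
          · exact hP₃.2.2 heq
          · exact hP₃.2.1.ne heq
    intro i j hij
    rcases lt_trichotomy i j with h | h | h
    · exact absurd hij (hlt i j h)
    · exact h
    · exact absurd hij.symm (hlt j i h)
  obtain ⟨k, e, he⟩ := hd.exists_embedding hinj ⟨hP₁, hP₂, hP₃⟩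
    (fun i j i' j' hi hj hi' hj' ha ha' => by
      obtain ⟨r1, r2⟩ := hx₁ _ (hm₁ i hi) _ (hm₂₃ j hj) ha
      obtain ⟨r3, r4⟩ := hx₁ _ (hm₁ i' hi') _ (hm₂₃ j' hj') ha'
      rw [r1] at ha
      rw [r3] at ha'
      exact ⟨hinj (r1.trans r3.symm), hinj (hd.unique _ _ _ ha ha' r2 r4)⟩)
    (fun i j i' j' hi hi6 hj hi' hi6' hj' ha ha' => by
      obtain ⟨r1, r2⟩ := hx₂ _ (hm₂ i hi hi6) _ (hm₃ j hj) ha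
      obtain ⟨r3, r4⟩ := hx₂ _ (hm₂ i' hi' hi6') _ (hm₃ j' hj') ha'
      rw [r1] at ha
      rw [r3] at ha'
      exact ⟨hinj (r1.trans r3.symm), hinj (hd.unique _ _ _ ha ha' r2 r4)⟩)
    (fun i j i' j' hi hj hi' hi6' hj' ha ha' => by
      obtain ⟨r1, r2⟩ := hx₁ _ (hm₁ i hi) _ (hm₂₃ j hj) ha
      obtain ⟨r3, r4⟩ := hx₂ _ (hm₂ i' hi' hi6') _ (hm₃ j' hj') ha'
      have := h (f j) (hm₂₃ j hj) (f j') (hm₃ j' hj') (r3 ▸ hm₂ i' hi' hi6') (r1 ▸ ha) (r3 ▸ ha')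
      exact ⟨fun h => this.1 (h ▸ r3), fun h => this.2 (h ▸ rfl)⟩)
  refine ⟨k, e, fun i => ?_⟩
  obtain ⟨j, hj⟩ := he i
  rw [hj]
  by_cases hj3 : j < 3
  · exact hU₁ (hm₁ j hj3)
  · rcases Finset.mem_union.1 (hm₂₃ j (by omega)) with h | h
    · exact hU₂ h
    · exact hU₃ h

/-- If every small set of vertices misses a path on three vertices in `U`, then `U` contains an
induced copy of a forest obstruction. -/
theorem IsDepth.exists_forestObstruction [Finite V] (hd : IsDepth G d) {U : Set V}
    (hU : ∀ A : Finset V, IsSmall G A → ∃ Q, IsP3Set G Q ∧ ↑Q ⊆ U ∧ Disjoint A Q) :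
    ∃ k, ∃ e : forestObstruction k ↪g G, ∀ i, e i ∈ U := by
  obtain ⟨Q₁, hQ₁, hU₁, x₁, hx₁, hlow₁⟩ := hd.exists_lowest U <| by
    obtain ⟨Q, hQ, hQU, -⟩ := hU ∅ (.inl (by simp))
    exact ⟨Q, hQ, hQU⟩
  obtain ⟨Q₂, hQ₂, hU₂, x₂, hx₂, hlow₂⟩ := hd.exists_lowest (U \ {x₁}) <| by
    obtain ⟨Q, hQ, hQU, hdisj⟩ := hU {x₁} (.inl (by simp))
    refine ⟨Q, hQ, fun v hv => ⟨hQU hv, ?_⟩⟩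
    rintro rfl
    simp_all
  have hx₁Q₂ : x₁ ∉ Q₂ := fun h => (hU₂ h).2 rfl
  obtain ⟨h₁₂, hc₁₂⟩ := hlow₁ Q₂ hQ₂ (hU₂.trans Set.sdiff_subset) hx₁Q₂
  -- Any third path avoiding both tops finishes the proof, provided that the two possible connecting
  -- edges have no common end.
  have key : ∀ Q₃, IsP3Set G Q₃ → ↑Q₃ ⊆ U → x₁ ∉ Q₃ → x₂ ∉ Q₃ →
      (∀ p₁ ∈ Q₂ ∪ Q₃, ∀ p₂ ∈ Q₃, G.Adj x₁ p₁ → G.Adj x₂ p₂ → p₁ ≠ x₂ ∧ p₁ ≠ p₂) →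
      ∃ k, ∃ e : forestObstruction k ↪g G, ∀ i, e i ∈ U := by
    intro Q₃ hQ₃ hU₃ h1 h2 h
    obtain ⟨h₁₃, hc₁₃⟩ := hlow₁ Q₃ hQ₃ hU₃ h1
    obtain ⟨h₂₃, hc₂₃⟩ := hlow₂ Q₃ hQ₃ (fun v hv => ⟨hU₃ hv, fun hv' => h1 (by
      rw [Set.mem_singleton_iff] at hv'
      exact hv' ▸ hv)⟩) h2
    refine hd.exists_embedding_of_disjoint hQ₁ hQ₂ hQ₃ h₁₂ h₁₃ h₂₃ hU₁
      (hU₂.trans Set.sdiff_subset) hU₃ (x₁ := x₁) (x₂ := x₂) ?_ hc₂₃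
      (fun p₁ hp₁ p₂ hp₂ _ => h p₁ hp₁ p₂ hp₂)
    intro y hy z hz
    exact (Finset.mem_union.1 hz).elim (hc₁₂ y hy z) (hc₁₃ y hy z)
  obtain ⟨Q₃, hQ₃, hU₃, hdisj⟩ := hU {x₁, x₂} (.inl Finset.card_le_two)
  have hx₁Q₃ : x₁ ∉ Q₃ := Finset.disjoint_left.1 hdisj (by simp)
  have hx₂Q₃ : x₂ ∉ Q₃ := Finset.disjoint_left.1 hdisj (by simp)
  by_cases hgood : ∀ p₁ ∈ Q₂ ∪ Q₃, ∀ p₂ ∈ Q₃, G.Adj x₁ p₁ → G.Adj x₂ p₂ → p₁ ≠ x₂ ∧ p₁ ≠ p₂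
  · exact key Q₃ hQ₃ hU₃ hx₁Q₃ hx₂Q₃ hgood
  push Not at hgood
  obtain ⟨p₁, hp₁, p₂, hp₂, ha₁, ha₂, hp⟩ := hgood
  have hx₁₂ : x₁ ≠ x₂ := by
    rintro rfl
    exact hx₁Q₂ hx₂
  have hx₁p₂ : x₁ ≠ p₂ := by
    rintro rfl
    exact hx₁Q₃ hp₂
  have hd₂ : d p₂ < d x₂ := by
    refine (hlow₂ Q₃ hQ₃ (fun v hv => ⟨hU₃ hv, ?_⟩) hx₂Q₃).2 _ hx₂ _ hp₂ ha₂ |>.2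
    rintro rfl
    exact hx₁Q₃ hv
  have hpar₂ : ∀ R, IsP3Set G R → ↑R ⊆ U → x₁ ∉ R → x₂ ∉ R → ∀ p ∈ R, G.Adj x₂ p → p = p₂ := by
    intro R hR hRU hxR hxR' p hp hxp
    refine hd.unique _ _ _ hxp ha₂ ((hlow₂ R hR (fun v hv => ⟨hRU hv, ?_⟩) hxR').2 _ hx₂ _ hp
      hxp).2 hd₂
    rintro rfl
    exact hxR hv
  -- The edges share an end in two ways: the parent of `x₁` is `x₂`, giving the path `x₁ - x₂ - p₂`,
  -- or both tops have parent `p₂`, giving `x₁ - p₂ - x₂`.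
  have hsmall : IsSmall G {x₁, x₂, p₂} := by
    by_cases h : p₁ = x₂
    · exact .inr ⟨x₁, x₂, p₂, ⟨h ▸ ha₁.symm, ha₂, hx₁p₂⟩, rfl⟩
    · refine .inr ⟨x₁, p₂, x₂, ⟨hp h ▸ ha₁.symm, ha₂.symm, hx₁₂⟩, ?_⟩
      rw [Finset.pair_comm]
  obtain ⟨R, hR, hRU, hRdisj⟩ := hU _ hsmall
  have hx₁R : x₁ ∉ R := Finset.disjoint_left.1 hRdisj (by simp)
  have hx₂R : x₂ ∉ R := Finset.disjoint_left.1 hRdisj (by simp)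
  have hp₂R : p₂ ∉ R := Finset.disjoint_left.1 hRdisj (by simp)
  -- The only possible neighbour of `x₂` in `R` is its parent `p₂`, which `R` avoids, so the
  -- condition on common ends is vacuous.
  refine key R hR hRU hx₁R hx₂R fun q₁ hq₁ q₂ hq₂ hxq₁ hxq₂ => ?_
  exact absurd (hpar₂ R hR hRU hx₁R hx₂R q₂ hq₂ hxq₂ ▸ hq₂) hp₂R

end Copy

/-! ### The forest obstructions are minimal -/

/-- The depths of the vertices of the forest obstructions. -/
def obstructionDepth : Fin 11 → List ℕ
  | 0 => [0, 1, 2, 0, 1, 2, 0, 1, 2]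
  | 1 => [0, 1, 2, 3, 4, 5, 0, 1, 2]
  | 2 => [0, 1, 2, 4, 3, 4, 0, 1, 2]
  | 3 => [0, 1, 2, 3, 2, 3, 0, 1, 2]
  | 4 => [0, 1, 2, 3, 4, 5, 6, 7, 8]
  | 5 => [0, 1, 2, 3, 4, 5, 7, 6, 7]
  | 6 => [0, 1, 2, 3, 4, 5, 5, 6, 7]
  | 7 => [0, 1, 2, 2, 3, 4, 4, 5, 6]
  | 8 => [0, 1, 2, 2, 3, 4, 5, 4, 5]
  | 9 => [0, 1, 2, 2, 3, 4, 6, 5, 6]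
  | 10 => [0, 1, 2, 3, 2, 3, 4, 5, 6]

theorem isDepth_forestObstruction (k : Fin 11) :
    IsDepth (forestObstruction k) fun v => (obstructionDepth k).getD v 0 where
  ne u v h := by
    rw [forestObstruction_adj] at h
    have : ∀ k u v, hasEdge (edges3P3 ++ addedEdges k) u v = true →
        (obstructionDepth k).getD u 0 ≠ (obstructionDepth k).getD v 0 := by decide +kernel
    exact this k u v h
  unique v u w hu hw := by
    rw [forestObstruction_adj] at hu hw
    have : ∀ k v u, hasEdge (edges3P3 ++ addedEdges k) v u = true →
        ∀ w, hasEdge (edges3P3 ++ addedEdges k) v w = true →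
        (obstructionDepth k).getD u 0 < (obstructionDepth k).getD v 0 →
        (obstructionDepth k).getD w 0 < (obstructionDepth k).getD v 0 → u = w := by
      decide +kernel
    exact this k v u hu w hw

/-- A valid `A` must meet each of the three disjoint paths. Two vertices are too few, and a finite
check shows that no P₃ of an obstruction meets all three. -/
theorem not_isMayaTupi_forestObstruction (k : Fin 11) : ¬ IsMayaTupi (forestObstruction k) := by
  rw [isMayaTupi_iff]
  rintro ⟨A, hA, hB⟩
  have hpath : ∀ (q : Fin 3) (k : Fin 11),
      hasEdge (edges3P3 ++ addedEdges k) ⟨3 * q + 1, by omega⟩ ⟨3 * q, by omega⟩ = true ∧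
      hasEdge (edges3P3 ++ addedEdges k) ⟨3 * q + 1, by omega⟩ ⟨3 * q + 2, by omega⟩ = true := by
    decide
  have hhit : ∀ q ∈ Finset.range 3, ∃ v ∈ A, v.val / 3 = q := by
    intro q hq
    by_contra! hcon
    rw [Finset.mem_range] at hq
    have hno : ∀ v : Fin 9, v.val / 3 = q → v ∉ A := fun v hv hvA => hcon v hvA hv
    refine hB ⟨3 * q, by omega⟩ (hno _ ?_) ⟨3 * q + 1, by omega⟩ (hno _ ?_) ⟨3 * q + 2, by omega⟩
      (hno _ ?_) ⟨?_, ?_, by simp⟩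
    · simp
    · simp only
      omega
    · simp only
      omega
    · exact forestObstruction_adj.2 (hpath ⟨q, hq⟩ k).1
    · exact forestObstruction_adj.2 (hpath ⟨q, hq⟩ k).2
  rcases (isDepth_forestObstruction k).isSmall hA with h | ⟨a, b, c, ⟨h1, h2, -⟩, rfl⟩
  · have : (Finset.range 3).card ≤ (A.image fun v => v.val / 3).card := by
      refine Finset.card_le_card fun q hq => ?_
      simpa using hhit q hq
    have := Finset.card_image_le (s := A) (f := fun v => v.val / 3)
    simp_all
    omega
  · rw [forestObstruction_adj] at h1 h2
    have : ∀ k b a, hasEdge (edges3P3 ++ addedEdges k) b a = true →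
        ∀ c, hasEdge (edges3P3 ++ addedEdges k) b c = true →
        ∃ q < 3, a.val / 3 ≠ q ∧ b.val / 3 ≠ q ∧ c.val / 3 ≠ q := by decide +kernel
    obtain ⟨q, hq, h3⟩ := this k b a h1 c h2
    have := hhit q (by simpa using hq)
    simp_all

/-- After deletion of any vertex `v`, some two vertices `x` and `y` meet all remaining P₃s, so what
is left of them in `S` serves as `A`. -/
theorem isMayaTupi_induce_forestObstruction (k : Fin 11) (S : Finset (Fin 9))
    (hS : S ≠ Finset.univ) : IsMayaTupi ((forestObstruction k).induce (S : Set (Fin 9))) := by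
  obtain ⟨v, hv⟩ : ∃ v, v ∉ S := by
    by_contra! h
    exact hS (Finset.eq_univ_of_forall h)
  have key : ∀ k v, ∃ x y, ∀ b, (b ≠ v ∧ b ≠ x ∧ b ≠ y) →
      ∀ a, (hasEdge (edges3P3 ++ addedEdges k) b a = true ∧ a ≠ v ∧ a ≠ x ∧ a ≠ y) →
      ∀ c, (hasEdge (edges3P3 ++ addedEdges k) b c = true ∧ c ≠ v ∧ c ≠ x ∧ c ≠ y) → a = c := by
    decide +kernel
  obtain ⟨x, y, hxy⟩ := key k v
  rw [isMayaTupi_iff]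
  refine ⟨Finset.univ.filter fun w => w.1 = x ∨ w.1 = y, ?_, ?_⟩
  · intro a ha b hb c hc hba hca hbc
    exfalso
    simp only [Finset.mem_filter, Finset.mem_univ, true_and] at ha hb hc
    simp only [ne_eq, Subtype.ext_iff] at hba hca hbc
    grind
  · rintro a ha b hb c hc ⟨h1, h2, h3⟩
    simp only [Finset.mem_filter, Finset.mem_univ, true_and, not_or] at ha hb hc
    have hne : ∀ w : (S : Set (Fin 9)), w.1 ≠ v := fun w h => hv (h ▸ w.2)
    refine h3 (Subtype.ext (hxy b ⟨hne b, hb⟩ a ⟨?_, hne a, ha⟩ c ⟨?_, hne c, hc⟩))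
    · exact forestObstruction_adj.1 h1
    · exact forestObstruction_adj.1 h2

theorem isMinimalMTObstruction_forestObstruction (k : Fin 11) :
    IsMinimalMTObstruction (forestObstruction k) :=
  ⟨not_isMayaTupi_forestObstruction k, isMayaTupi_induce_forestObstruction k⟩

/-! ### Weakest preconditions -/

/-- Started in state `s`, program `p` halts, and the running time `t` and the final state `s'`
satisfy `Q t s'`. -/
def wp (W : ℕ) (p : RAMProg) (s : RAMState) (Q : ℕ → RAMState → Prop) : Prop :=
  ∃ t s', Exec W p s t s' ∧ Q t s'

section WP

variable {W : ℕ} {s : RAMState} {Q Q' : ℕ → RAMState → Prop}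

theorem wp_mono {p : RAMProg} (h : wp W p s Q) (hQ : ∀ t s', Q t s' → Q' t s') :
    wp W p s Q' := by
  obtain ⟨t, s', h1, h2⟩ := h
  exact ⟨t, s', h1, hQ _ _ h2⟩

theorem wp_skip : wp W .skip s Q ↔ Q 1 s := by
  constructor
  · rintro ⟨t, s', h, hQ⟩
    cases h
    exact hQ
  · exact fun h => ⟨_, _, .skip s, h⟩

theorem wp_assign {x : ℕ} {e : Rhs} :
    wp W (.assign x e) s Q ↔ e.eval s ≤ W ∧ Q 1 (s.setReg x (e.eval s)) := by
  constructor
  · rintro ⟨t, s', h, hQ⟩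
    cases h
    exact ⟨by assumption, hQ⟩
  · exact fun h => ⟨_, _, .assign s x e h.1, h.2⟩

theorem wp_store {a y x : ℕ} :
    wp W (.store a y x) s Q ↔ Q 1 (s.setArr a (s.reg y) (s.reg x)) := by
  constructor
  · rintro ⟨t, s', h, hQ⟩
    cases h
    exact hQ
  · exact fun h => ⟨_, _, .store s a y x, h⟩

theorem wp_seq {p q : RAMProg} :
    wp W (.seq p q) s Q ↔ wp W p s fun t s' => wp W q s' fun t' s'' => Q (t + t') s'' := by
  constructor
  · rintro ⟨t, s', h, hQ⟩
    cases h with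
    | seq h1 h2 => exact ⟨_, _, h1, _, _, h2, hQ⟩
  · rintro ⟨t, s', h1, t', s'', h2, hQ⟩
    exact ⟨_, _, .seq h1 h2, hQ⟩

theorem wp_ite {b : RAMTest} {p q : RAMProg} : wp W (.ite b p q) s Q ↔
    (b.Holds s → wp W p s fun t s' => Q (t + 1) s') ∧
      (¬ b.Holds s → wp W q s fun t s' => Q (t + 1) s') := by
  constructor
  · rintro ⟨t, s', h, hQ⟩
    cases h with
    | ite_true hb hp => exact ⟨fun _ => ⟨_, _, hp, hQ⟩, fun h => absurd hb h⟩
    | ite_false hb hp => exact ⟨fun h => absurd h hb, fun _ => ⟨_, _, hp, hQ⟩⟩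
  · rintro ⟨h1, h2⟩
    by_cases hb : b.Holds s
    · obtain ⟨t, s', h, hQ⟩ := h1 hb
      exact ⟨_, _, .ite_true hb h, hQ⟩
    · obtain ⟨t, s', h, hQ⟩ := h2 hb
      exact ⟨_, _, .ite_false hb h, hQ⟩

/-- The rule for loops, with an invariant `I` and a potential `Φ` that pays for the running time. -/
theorem wp_while {b : RAMTest} {p : RAMProg} (I : RAMState → Prop) (Φ : RAMState → ℕ)
    (hI : I s)
    (hp : ∀ s, I s → b.Holds s → wp W p s fun t s' => I s' ∧ t + 1 + Φ s' ≤ Φ s)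
    (hQ : ∀ t s', I s' → ¬ b.Holds s' → t ≤ Φ s + 1 → Q t s') : wp W (.while b p) s Q := by
  -- Induction on a bound for the potential, which drops by at least one per iteration. This also
  -- gives termination.
  suffices H : ∀ N s, Φ s ≤ N → I s →
      ∃ t s', Exec W (.while b p) s t s' ∧ I s' ∧ ¬ b.Holds s' ∧ t ≤ Φ s + 1 by
    obtain ⟨t, s', h, h1, h2, h3⟩ := H _ s le_rfl hI
    exact ⟨t, s', h, hQ t s' h1 h2 h3⟩
  intro N
  induction N with
  | zero =>
    intro s hN hI
    by_cases hb : b.Holds s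
    · obtain ⟨t, s', -, -, h⟩ := hp s hI hb
      omega
    · exact ⟨1, s, .while_false hb, hI, hb, by omega⟩
  | succ N ih =>
    intro s hN hI
    by_cases hb : b.Holds s
    · obtain ⟨t, s', hx, hI', h⟩ := hp s hI hb
      obtain ⟨t', s'', hx', h1, h2, h3⟩ := ih s' (by omega) hI'
      exact ⟨_, _, .while_true hb hx hx', h1, h2, by omega⟩
    · exact ⟨1, s, .while_false hb, hI, hb, by omega⟩

end WP

section State

variable (s : RAMState)

theorem setReg_reg (x v y : ℕ) : (s.setReg x v).reg y = if y = x then v else s.reg y := by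
  simp [RAMState.setReg, Function.update_apply]

theorem setReg_arr (x v : ℕ) : (s.setReg x v).arr = s.arr := rfl

theorem setArr_reg (a i v : ℕ) : (s.setArr a i v).reg = s.reg := rfl

theorem setArr_arr (a i v b j : ℕ) :
    (s.setArr a i v).arr b j = if b = a ∧ j = i then v else s.arr b j := by
  by_cases hb : b = a
  · subst hb
    simp [RAMState.setArr, Function.update_apply]
  · simp [RAMState.setArr, hb]

end State

infixr:60 ";;" => RAMProg.seq

/-! ### Adjacency lists -/

/-- What the programs need to know about adjacency lists. -/
structure IsListing (n : ℕ) (off nbr : ℕ → ℕ) : Prop where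
  off_le : ∀ v < n, off v ≤ off (v + 1)
  off_bound : ∀ v ≤ n, off v ≤ 2 * n
  nbr_lt : ∀ v < n, ∀ j, off v ≤ j → j < off (v + 1) → nbr j < n

/-- The input is in place. -/
structure HasInput (n : ℕ) (off nbr : ℕ → ℕ) (s : RAMState) : Prop where
  reg_zero : s.reg 0 = n
  arr_zero : s.arr 0 = off
  arr_one : s.arr 1 = nbr

/-- The arrays are the same, and so are the registers other than `3, …, 19`. -/
structure SameOutside (s s' : RAMState) : Prop where
  arr : s'.arr = s.arr
  reg : ∀ r, r < 3 ∨ 20 ≤ r → s'.reg r = s.reg r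

theorem SameOutside.refl (s : RAMState) : SameOutside s s := ⟨rfl, fun _ _ => rfl⟩

theorem SameOutside.trans {s s' s'' : RAMState} (h : SameOutside s s')
    (h' : SameOutside s' s'') : SameOutside s s'' :=
  ⟨h'.arr.trans h.arr, fun r hr => (h'.reg r hr).trans (h.reg r hr)⟩

theorem SameOutside.setReg {s s' : RAMState} (h : SameOutside s s') {x v : ℕ} (hx : 3 ≤ x)
    (hx' : x < 20) : SameOutside s (s'.setReg x v) := by
  refine ⟨h.arr, fun r hr => ?_⟩
  rw [setReg_reg, if_neg (by omega), h.reg r hr]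

theorem SameOutside.hasInput {n : ℕ} {off nbr : ℕ → ℕ} {s s' : RAMState} (h : SameOutside s s')
    (hs : HasInput n off nbr s) : HasInput n off nbr s' :=
  ⟨(h.reg 0 (by omega)).trans hs.reg_zero, h.arr ▸ hs.arr_zero, h.arr ▸ hs.arr_one⟩

/-! ### Adjacency test -/

/-- Sets register `6` to `1` if the vertices in registers `x` and `y` are adjacent, and to `0`
otherwise. -/
def testAdj (x y : ℕ) : RAMProg :=
  .assign 3 (.copy x) ;; .assign 4 (.copy y) ;;
  .assign 7 (.const 1) ;; .assign 9 (.load 0 3) ;; .assign 10 (.add 3 7) ;;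
  .assign 11 (.load 0 10) ;; .assign 6 (.const 0) ;;
  .while (.lt 9 11)
    (.assign 13 (.load 1 9) ;; .ite (.eq 13 4) (.assign 6 (.const 1)) .skip ;;
      .assign 9 (.add 9 7))

theorem wp_testAdj {W n : ℕ} {off nbr : ℕ → ℕ} (hL : IsListing n off nbr)
    (hW : 3 * n + 200 ≤ W) {s : RAMState} (hs : HasInput n off nbr s) {x y : ℕ}
    (hy : 20 ≤ y) (hxn : s.reg x < n) (hyn : s.reg y < n) :
    wp W (testAdj x y) s fun t s' => t ≤ 20 * n + 20 ∧ SameOutside s s' ∧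
      (s'.reg 6 = 0 ∨ s'.reg 6 = 1) ∧
      (s'.reg 6 = 1 ↔ ∃ j, off (s.reg x) ≤ j ∧ j < off (s.reg x + 1) ∧ nbr j = s.reg y) := by
  have hb0 := hL.off_bound _ hxn.le
  have hb1 := hL.off_bound _ (Nat.succ_le_of_lt hxn)
  have hle := hL.off_le _ hxn
  simp only [Nat.succ_eq_add_one] at hb1
  -- Register `3` is overwritten before register `y` is read.
  have hy3 : y ≠ 3 := by omega
  simp +decide only [testAdj, wp_seq, wp_assign, Rhs.eval, setReg_reg, setReg_arr, hs.arr_zero, hy3,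
    if_true, if_false]
  refine ⟨by omega, by omega, by omega, by omega, by omega, by omega, by omega, ?_⟩
  refine wp_while (fun s' => SameOutside s s' ∧ s'.reg 4 = s.reg y ∧ s'.reg 7 = 1 ∧
    s'.reg 11 = off (s.reg x + 1) ∧ off (s.reg x) ≤ s'.reg 9 ∧ s'.reg 9 ≤ off (s.reg x + 1) ∧
    (s'.reg 6 = 0 ∨ s'.reg 6 = 1) ∧
    (s'.reg 6 = 1 ↔ ∃ j, off (s.reg x) ≤ j ∧ j < s'.reg 9 ∧ nbr j = s.reg y))
    (fun s' => 10 * (s'.reg 11 - s'.reg 9)) ?_ ?_ ?_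
  · refine ⟨?_, ?_⟩
    · repeat refine SameOutside.setReg ?_ (by omega) (by omega)
      exact SameOutside.refl s
    · simp +decide only [setReg_reg, if_true, if_false, true_and, le_refl, hle, false_iff]
      rintro ⟨j, h1, h2, -⟩
      omega
  · rintro s' ⟨hsame, h4, h7, h11, h9, h9', h6, h6'⟩ hb
    have hs' := hsame.hasInput hs
    simp only [RAMTest.Holds] at hb
    have hn := hL.nbr_lt _ hxn (s'.reg 9) h9 (by omega)
    simp +decide only [wp_seq, wp_assign, wp_ite, wp_skip, Rhs.eval, RAMTest.Holds, setReg_reg,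
      hs'.arr_one, if_true, if_false, h7, h4, h11]
    refine ⟨by omega, fun heq => ⟨by omega, by omega, ⟨?_, ?_⟩, by omega⟩,
      fun hne => ⟨by omega, ⟨?_, ?_⟩, by omega⟩⟩
    · repeat refine SameOutside.setReg ?_ (by omega) (by omega)
      exact hsame
    · simp only [true_and, true_iff]
      exact ⟨by omega, by omega, _, h9, by omega, heq⟩
    · repeat refine SameOutside.setReg ?_ (by omega) (by omega)
      exact hsame
    · simp only [true_and]
      refine ⟨by omega, by omega, h6, h6'.trans (exists_congr fun j => and_congr_right fun _ => ?_)⟩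
      refine ⟨fun h => ⟨by omega, h.2⟩, fun h => ⟨?_, h.2⟩⟩
      have : j ≠ s'.reg 9 := by
        rintro rfl
        exact hne h.2
      omega
  · rintro t s' ⟨hsame, h4, h7, h11, h9, h9', h6, hiff⟩ hb ht
    simp +decide only [RAMTest.Holds, setReg_reg, if_true, if_false] at hb ht
    have : s'.reg 9 = off (s.reg x + 1) := by omega
    rw [this] at hiff
    exact ⟨by omega, hsame, h6, hiff⟩

/-! ### Finding a path on three vertices -/

/-- Runs through the neighbours of the vertex in register `5`, looking for two of them whose
marks agree with register `4`. -/
def scanNeighbours : RAMProg :=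
  .while (.lt 9 11)
    (.assign 13 (.load 1 9) ;; .assign 14 (.load 2 13) ;;
      .ite (.eq 14 4)
        (.ite (.eq 12 7)
          (.assign 6 (.const 1) ;; .assign 16 (.copy 15) ;; .assign 17 (.copy 5) ;;
            .assign 18 (.copy 13))
          (.assign 12 (.const 1) ;; .assign 15 (.copy 13)))
        .skip ;;
      .assign 9 (.add 9 7))

/-- Sets register `6` to `1` and puts a path on three vertices with marks `m` into registers
`16`, `17` and `18`, or sets register `6` to `0` if there is no such path. The marks are in
array `2`. -/
def findP3 (m : ℕ) : RAMProg :=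
  .assign 4 (.const m) ;; .assign 5 (.const 0) ;; .assign 6 (.const 0) ;; .assign 7 (.const 1) ;;
  .while (.lt 5 0)
    (.assign 8 (.load 2 5) ;; .assign 9 (.load 0 5) ;; .assign 10 (.add 5 7) ;;
      .assign 11 (.load 0 10) ;; .assign 12 (.const 0) ;;
      .ite (.eq 8 4) scanNeighbours .skip ;;
      .assign 5 (.copy 10))

/-- Registers `16`, `17` and `18` hold a path on three vertices with marks `m`. -/
def HoldsP3 (n : ℕ) (off nbr mark : ℕ → ℕ) (m : ℕ) (s : RAMState) : Prop :=
  ∃ v < n, mark v = m ∧ ∃ i j, off v ≤ i ∧ i < off (v + 1) ∧ off v ≤ j ∧ j < off (v + 1) ∧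
    i ≠ j ∧ mark (nbr i) = m ∧ mark (nbr j) = m ∧ s.reg 16 = nbr i ∧ s.reg 17 = v ∧
      s.reg 18 = nbr j

/-- No path on three vertices with marks `m` has center `v`. -/
def NoP3At (off nbr mark : ℕ → ℕ) (m v : ℕ) : Prop :=
  mark v = m → ∀ i j, off v ≤ i → i < off (v + 1) → off v ≤ j → j < off (v + 1) →
    mark (nbr i) = m → mark (nbr j) = m → i = j

theorem HoldsP3.congr {n : ℕ} {off nbr mark : ℕ → ℕ} {m : ℕ} {s s' : RAMState}
    (h : HoldsP3 n off nbr mark m s) (h16 : s'.reg 16 = s.reg 16) (h17 : s'.reg 17 = s.reg 17)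
    (h18 : s'.reg 18 = s.reg 18) : HoldsP3 n off nbr mark m s' := by
  rw [HoldsP3, h16, h17, h18]
  exact h

section

variable {W n : ℕ} {off nbr : ℕ → ℕ} {s : RAMState} {m : ℕ}

theorem wp_scanNeighbours (hL : IsListing n off nbr) (hW : 3 * n + 200 ≤ W)
    (hs : HasInput n off nbr s) (hmark : ∀ v < n, s.arr 2 v ≤ 1) {v : ℕ} (hv : v < n)
    (h4 : s.reg 4 = m) (h5 : s.reg 5 = v) (h7 : s.reg 7 = 1) (h9 : s.reg 9 = off v)
    (h10 : s.reg 10 = v + 1) (h11 : s.reg 11 = off (v + 1)) (h12 : s.reg 12 = 0)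
    (hm : s.arr 2 v = m)
    (h6 : s.reg 6 = 1 ∧ HoldsP3 n off nbr (s.arr 2) m s ∨
      s.reg 6 = 0 ∧ ∀ u < v, NoP3At off nbr (s.arr 2) m u) :
    wp W scanNeighbours s fun t s' => t ≤ 12 * (off (v + 1) - off v) + 1 ∧ SameOutside s s' ∧
      s'.reg 4 = m ∧ s'.reg 7 = 1 ∧ s'.reg 10 = v + 1 ∧
      (s'.reg 6 = 1 ∧ HoldsP3 n off nbr (s.arr 2) m s' ∨
        s'.reg 6 = 0 ∧ ∀ u < v + 1, NoP3At off nbr (s.arr 2) m u) := by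
  have hb1 := hL.off_bound _ (Nat.succ_le_of_lt hv)
  have hle := hL.off_le _ hv
  simp only [Nat.succ_eq_add_one] at hb1
  refine wp_while (fun s' => SameOutside s s' ∧ s'.reg 4 = m ∧ s'.reg 5 = v ∧ s'.reg 7 = 1 ∧
    s'.reg 10 = v + 1 ∧ s'.reg 11 = off (v + 1) ∧ off v ≤ s'.reg 9 ∧ s'.reg 9 ≤ off (v + 1) ∧
    -- Register `12` tells whether a neighbour with mark `m` has been seen, and register `15` keeps
    -- the first one. That it is the only one is claimed just while register `6` is 0, since the
    -- scan goes on after a path is found.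
    (s'.reg 12 = 0 ∧ (∀ j, off v ≤ j → j < s'.reg 9 → s.arr 2 (nbr j) ≠ m) ∨
      s'.reg 12 = 1 ∧ ∃ i, off v ≤ i ∧ i < s'.reg 9 ∧ s'.reg 15 = nbr i ∧ s.arr 2 (nbr i) = m ∧
        (s'.reg 6 = 0 → ∀ j, off v ≤ j → j < s'.reg 9 → s.arr 2 (nbr j) = m → j = i)) ∧
    (s'.reg 6 = 1 ∧ HoldsP3 n off nbr (s.arr 2) m s' ∨
      s'.reg 6 = 0 ∧ ∀ u < v, NoP3At off nbr (s.arr 2) m u))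
    (fun s' => 12 * (s'.reg 11 - s'.reg 9)) ?_ ?_ ?_
  · exact ⟨SameOutside.refl s, h4, h5, h7, h10, h11, by omega, by omega,
      .inl ⟨h12, by omega⟩, h6⟩
  · clear h4 h5 h6 h7 h9 h10 h11 h12
    rintro s' ⟨hsame, h4, h5, h7, h10, h11, h9, h9', h12, h6⟩ hb
    have hs' := hsame.hasInput hs
    simp only [RAMTest.Holds] at hb
    have hn := hL.nbr_lt _ hv (s'.reg 9) h9 (by omega)
    have hmk := hmark _ hn
    simp +decide only [wp_seq, wp_assign, wp_ite, wp_skip, Rhs.eval, RAMTest.Holds, setReg_reg,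
      setReg_arr, hs'.arr_one, hsame.arr, if_true, if_false, h7, h4, h5, h10, h11, true_and]
    refine ⟨by omega, by omega, fun heq => ⟨fun h12' => ?_, fun h12' => ?_⟩, fun hne => ?_⟩
    · obtain ⟨i, hi, hi9, h15, him, -⟩ := (h12.resolve_left (by omega)).2
      have hni := hL.nbr_lt _ hv i hi (by omega)
      refine ⟨by omega, by omega, by omega, by omega, by omega,
        ⟨?_, by omega, by omega, .inr ⟨h12', i, hi, by omega, h15, him, False.elim⟩, .inl ?_⟩,
        by omega⟩
      · repeat refine SameOutside.setReg ?_ (by omega) (by omega)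
        exact hsame
      · refine ⟨v, hv, hm, i, s'.reg 9, hi, by omega, h9, by omega, by omega, him, heq, ?_⟩
        simp +decide only [setReg_reg, if_true, if_false, h15, true_and]
    · have h12'' := (h12.resolve_right (by omega)).2
      refine ⟨by omega, by omega, by omega, ⟨?_, by omega, by omega, ?_, ?_⟩, by omega⟩
      · repeat refine SameOutside.setReg ?_ (by omega) (by omega)
        exact hsame
      · refine .inr ⟨s'.reg 9, h9, by omega, rfl, heq, fun _ j hj hj' hjm => ?_⟩
        by_contra hne
        exact h12'' j hj (by omega) hjm
      · refine h6.imp_left (And.imp_right fun h => h.congr ?_ ?_ ?_) <;>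
          simp +decide only [setReg_reg, if_false]
    · refine ⟨by omega, ⟨?_, by omega, by omega, ?_, ?_⟩, by omega⟩
      · repeat refine SameOutside.setReg ?_ (by omega) (by omega)
        exact hsame
      · have hne' : ∀ j, s.arr 2 (nbr j) = m → j < s'.reg 9 + 1 → j < s'.reg 9 := by
          intro j hj hj'
          have : j ≠ s'.reg 9 := by
            rintro rfl
            exact hne hj
          omega
        rcases h12 with ⟨h1, h2⟩ | ⟨h1, i, hi, hi9, h15, him, h2⟩
        · exact .inl ⟨h1, fun j hj hj' hjm => h2 j hj (hne' j hjm hj') hjm⟩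
        · exact .inr ⟨h1, i, hi, by omega, h15, him,
            fun h j hj hj' hjm => h2 h j hj (hne' j hjm hj') hjm⟩
      · refine h6.imp_left (And.imp_right fun h => h.congr ?_ ?_ ?_) <;>
          simp +decide only [setReg_reg, if_false]
  · clear h4 h5 h6 h7 h10 h12
    rintro t s' ⟨hsame, h4, h5, h7, h10, h11', h9', h9'', h12, h6⟩ hb ht
    simp only [RAMTest.Holds] at hb
    have h9e : s'.reg 9 = off (v + 1) := by omega
    rw [h9e] at h12
    refine ⟨by rw [h9, h11] at ht; exact ht, hsame, h4, h7, h10, h6.imp_right fun h => ⟨h.1, ?_⟩⟩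
    intro u hu
    by_cases huv : u < v
    · exact h.2 u huv
    obtain rfl : u = v := by omega
    intro _ i j hi hi' hj hj' him hjm
    rcases h12 with ⟨-, h2⟩ | ⟨-, i', -, -, -, -, h2⟩
    · exact absurd him (h2 i hi hi')
    · rw [h2 h.1 i hi hi' him, h2 h.1 j hj hj' hjm]

/-- The potential charges 20 per vertex and 12 per list entry; with at most `2 * n` entries this
gives `44 * n`. -/
theorem wp_findP3 (hL : IsListing n off nbr) (hW : 3 * n + 200 ≤ W) (hs : HasInput n off nbr s)
    (hmark : ∀ v < n, s.arr 2 v ≤ 1) (hm : m ≤ 1) :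
    wp W (findP3 m) s fun t s' => t ≤ 44 * n + 10 ∧ SameOutside s s' ∧
      (s'.reg 6 = 1 ∧ HoldsP3 n off nbr (s.arr 2) m s' ∨
        s'.reg 6 = 0 ∧ ∀ v < n, NoP3At off nbr (s.arr 2) m v) := by
  simp +decide only [findP3, wp_seq, wp_assign, Rhs.eval]
  refine ⟨by omega, by omega, by omega, by omega, ?_⟩
  refine wp_while (fun s' => SameOutside s s' ∧ s'.reg 4 = m ∧ s'.reg 7 = 1 ∧ s'.reg 5 ≤ n ∧
    (s'.reg 6 = 1 ∧ HoldsP3 n off nbr (s.arr 2) m s' ∨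
      s'.reg 6 = 0 ∧ ∀ u < s'.reg 5, NoP3At off nbr (s.arr 2) m u))
    (fun s' => 20 * (n - s'.reg 5) + 12 * (off n - off (s'.reg 5))) ?_ ?_ ?_
  · refine ⟨?_, ?_⟩
    · repeat refine SameOutside.setReg ?_ (by omega) (by omega)
      exact SameOutside.refl s
    · simp +decide only [setReg_reg, if_true, if_false, true_and]
      simp
  · rintro s' ⟨hsame, h4, h7, h5, h6⟩ hb
    have hs' := hsame.hasInput hs
    simp only [RAMTest.Holds, hs'.reg_zero] at hb
    have hb0 := hL.off_bound _ hb.le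
    have hb1 := hL.off_bound _ (Nat.succ_le_of_lt hb)
    have hle := hL.off_le _ hb
    -- Needed because the subtraction in the potential is truncated.
    have hmono : off (s'.reg 5 + 1) ≤ off n := by
      have : ∀ k, s'.reg 5 + 1 + k ≤ n → off (s'.reg 5 + 1) ≤ off (s'.reg 5 + 1 + k) := by
        intro k
        induction k with
        | zero => simp
        | succ k ih => exact fun h => (ih (by omega)).trans (hL.off_le _ (by omega))
      have h := this (n - (s'.reg 5 + 1)) (by omega)
      rwa [Nat.add_sub_cancel' (by omega)] at h
    simp only [Nat.succ_eq_add_one] at hb1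
    have hmk := hmark _ hb
    simp +decide only [wp_seq, wp_assign, Rhs.eval, setReg_reg, setReg_arr, hs'.arr_zero,
      hsame.arr, if_true, if_false, h7, wp_ite, wp_skip, RAMTest.Holds, h4]
    refine ⟨by omega, by omega, by omega, by omega, by omega, fun hm => ?_, fun hm => ?_⟩
    · refine wp_mono (wp_scanNeighbours hL hW ?_ ?_ hb (m := m) ?_ ?_ ?_ ?_ ?_ ?_ ?_ ?_ ?_) ?_
      · refine SameOutside.hasInput ?_ hs'
        repeat refine SameOutside.setReg ?_ (by omega) (by omega)
        exact SameOutside.refl s'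
      · simp only [setReg_arr, hsame.arr]
        exact hmark
      iterate 7 simp +decide only [setReg_reg, if_true, if_false, h4, h7]
      · rw [← hm, setReg_arr, setReg_arr, setReg_arr, setReg_arr, setReg_arr, hsame.arr]
      · simp +decide only [setReg_reg, setReg_arr, if_false, hsame.arr]
        refine h6.imp_left (And.imp_right fun h => h.congr ?_ ?_ ?_) <;>
          simp +decide only [setReg_reg, if_false]
      · rintro t s'' ⟨ht, hsame', h4', h7', h10', h6'⟩
        simp only [setReg_arr, hsame.arr] at h6'
        simp only [h4', h7', h10', true_and]
        refine ⟨by omega, ⟨?_, by omega, ?_⟩, by omega⟩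
        · refine SameOutside.setReg (SameOutside.trans ?_ hsame') (by omega) (by omega)
          repeat refine SameOutside.setReg ?_ (by omega) (by omega)
          exact hsame
        · refine h6'.imp_left (And.imp_right fun h => h.congr ?_ ?_ ?_) <;>
            simp +decide only [setReg_reg, if_false]
    · refine ⟨by omega, ⟨?_, by trivial, by trivial, by omega, ?_⟩, by omega⟩
      · repeat refine SameOutside.setReg ?_ (by omega) (by omega)
        exact hsame
      · rcases h6 with ⟨h1, h2⟩ | ⟨h1, h2⟩
        · refine .inl ⟨h1, h2.congr ?_ ?_ ?_⟩ <;> simp +decide only [setReg_reg, if_false]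
        · refine .inr ⟨h1, fun u hu => ?_⟩
          by_cases huv : u < s'.reg 5
          · exact h2 u huv
          · obtain rfl : u = s'.reg 5 := by omega
            exact fun h => absurd h hm
  · rintro t s' ⟨hsame, h4, h7, h5, h6⟩ hb ht
    simp only [RAMTest.Holds, (hsame.hasInput hs).reg_zero] at hb
    have hbn := hL.off_bound n le_rfl
    have h5n : s'.reg 5 = n := by omega
    simp +decide only [setReg_reg, if_true, if_false] at ht
    rw [h5n] at h6
    exact ⟨by omega, hsame, h6⟩

end

/-! ### Adjacency lists and the graph -/

section Listing

variable {n : ℕ} {G : SimpleGraph (Fin n)} {off nbr : ℕ → ℕ}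

theorem IsAdjacencyList.adj_iff (h : IsAdjacencyList G off nbr) {u v : Fin n} :
    G.Adj u v ↔ ∃ j, off u ≤ j ∧ j < off (u + 1) ∧ nbr j = v := by
  have := (h.nbr_bijOn u).image_eq
  constructor
  · intro huv
    have hv : v.val ∈ Fin.val '' G.neighborSet u := ⟨v, huv, rfl⟩
    rw [← this] at hv
    obtain ⟨j, ⟨h1, h2⟩, h3⟩ := hv
    exact ⟨j, h1, h2, h3⟩
  · rintro ⟨j, h1, h2, h3⟩
    have hv : v.val ∈ Fin.val '' G.neighborSet u := by
      rw [← this]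
      exact ⟨j, ⟨h1, h2⟩, h3⟩
    obtain ⟨w, hw, hwv⟩ := hv
    rwa [Fin.val_injective hwv] at hw

theorem IsAdjacencyList.nbr_lt (h : IsAdjacencyList G off nbr) {u : Fin n} {j : ℕ}
    (h1 : off u ≤ j) (h2 : j < off (u + 1)) : nbr j < n := by
  obtain ⟨w, -, hw⟩ := (h.nbr_bijOn u).mapsTo ⟨h1, h2⟩
  rw [← hw]
  exact w.2

/-- The offsets are partial sums of degrees. A tree has `n - 1` edges, so the total is below `2 *
n`; this is what makes each scan linear in `n`. -/
theorem IsAdjacencyList.isListing (h : IsAdjacencyList G off nbr) (hG : G.IsTree) :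
    IsListing n off nbr := by
  classical
  have hdeg (v : Fin n) : off (v + 1) = off v + G.degree v := by
    have h1 := Set.InjOn.ncard_image (h.nbr_bijOn v).injOn
    rw [(h.nbr_bijOn v).image_eq, Set.ncard_image_of_injective _ Fin.val_injective,
      ← Nat.card_coe_set_eq, Nat.card_eq_fintype_card, SimpleGraph.card_neighborSet_eq_degree,
      ← Finset.coe_Ico, Set.ncard_coe_finset, Nat.card_Ico] at h1
    have := h.off_le v v.2
    omega
  have hoff : ∀ i (hi : i ≤ n), off i = ∑ v : Fin i, G.degree (v.castLE hi) := by
    intro i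
    induction i with
    | zero => simp [h.off_zero]
    | succ i ih =>
      intro hi
      rw [Fin.sum_univ_castSucc, hdeg ⟨i, by omega⟩]
      simp only
      rw [ih (by omega)]
      rfl
  have hn : off n ≤ 2 * n := by
    rw [hoff n le_rfl]
    have h1 := G.sum_degrees_eq_twice_card_edges
    have h2 := hG.card_edgeFinset
    rw [Fintype.card_fin] at h2
    simp only [Fin.castLE_rfl, id_eq]
    omega
  refine ⟨h.off_le, fun v hv => ?_, fun v hv j h1 h2 => h.nbr_lt (u := ⟨v, hv⟩) h1 h2⟩
  refine le_trans ?_ hn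
  induction hv using Nat.decreasingInduction with
  | self => rfl
  | of_succ k hk ih => exact (h.off_le k hk).trans ih

theorem HoldsP3.exists_isP3 (h : IsAdjacencyList G off nbr) {mark : ℕ → ℕ} {m : ℕ} {s : RAMState}
    (hs : HoldsP3 n off nbr mark m s) : ∃ a b c : Fin n, IsP3 G a b c ∧ mark a = m ∧
      mark b = m ∧ mark c = m ∧ s.reg 16 = a ∧ s.reg 17 = b ∧ s.reg 18 = c := by
  obtain ⟨v, hv, hm, i, j, h1, h2, h3, h4, h5, h6, h7, h8, h9, h10⟩ := hs
  have hi := h.nbr_lt (u := ⟨v, hv⟩) h1 h2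
  have hj := h.nbr_lt (u := ⟨v, hv⟩) h3 h4
  refine ⟨⟨nbr i, hi⟩, ⟨v, hv⟩, ⟨nbr j, hj⟩, ⟨?_, ?_, ?_⟩, h6, hm, h7, h8, h9, h10⟩
  · exact h.adj_iff.2 ⟨i, h1, h2, rfl⟩
  · exact h.adj_iff.2 ⟨j, h3, h4, rfl⟩
  · intro heq
    simp only [Fin.mk.injEq] at heq
    exact h5 ((h.nbr_bijOn ⟨v, hv⟩).injOn ⟨h1, h2⟩ ⟨h3, h4⟩ heq)

theorem not_isP3_of_noP3At (h : IsAdjacencyList G off nbr) {mark : ℕ → ℕ} {m : ℕ}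
    (hm : ∀ v < n, NoP3At off nbr mark m v) {a b c : Fin n} (ha : mark a = m) (hb : mark b = m)
    (hc : mark c = m) : ¬ IsP3 G a b c := by
  rintro ⟨h1, h2, h3⟩
  obtain ⟨i, hi1, hi2, hi3⟩ := h.adj_iff.1 h1
  obtain ⟨j, hj1, hj2, hj3⟩ := h.adj_iff.1 h2
  have := hm b b.2 hb i j hi1 hi2 hj1 hj2 (by rw [hi3, ha]) (by rw [hj3, hc])
  subst this
  exact h3 (Fin.val_injective (hi3.symm.trans hj3))

end Listing

/-! ### The search for an MT-partition -/

/-- Pushes registers `16`, `17` and `18` on the stack in array `3`, whose height is in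
register `20`. -/
def pushP3 : RAMProg :=
  .assign 19 (.const 1) ;; .store 3 20 16 ;; .assign 20 (.add 20 19) ;; .store 3 20 17 ;;
  .assign 20 (.add 20 19) ;; .store 3 20 18 ;; .assign 20 (.add 20 19)

/-- Unless the answer is already known, runs `p` with the vertex in register `x` marked. -/
def branch (p : RAMProg) (x : ℕ) : RAMProg :=
  .assign 19 (.const 0) ;;
  .ite (.eq 1 19)
    (.assign 19 (.const 1) ;; .store 2 x 19 ;; p ;; .assign 19 (.const 0) ;;
      .ite (.eq 1 19) (.store 2 x 19) .skip)
    .skip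

/-- Looks for an MT-partition in which the marked vertices and at most `d` others are in `A`. The
paths found on the way are pushed on the stack. -/
def search : ℕ → RAMProg
  | 0 =>
    findP3 1 ;; .assign 19 (.const 1) ;;
    .ite (.eq 6 19)
      (findP3 0 ;; .assign 19 (.const 1) ;; .ite (.eq 6 19) pushP3 (.assign 1 (.const 1)))
      .skip
  | d + 1 =>
    findP3 0 ;; .assign 19 (.const 1) ;;
    .ite (.eq 6 19)
      (pushP3 ;; .assign (30 + 3 * d) (.copy 16) ;; .assign (31 + 3 * d) (.copy 17) ;;
        .assign (32 + 3 * d) (.copy 18) ;; branch (search d) (30 + 3 * d) ;;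
        branch (search d) (31 + 3 * d) ;; branch (search d) (32 + 3 * d))
      (.assign 1 (.const 1))

/-- The input is in place, and the stack consists of vertices. -/
structure Ready (n : ℕ) (off nbr : ℕ → ℕ) (s : RAMState) : Prop extends HasInput n off nbr s where
  -- This includes the cells above the top, which initially hold the vertex 0, so every tuple of
  -- cells can be tested without regard to the height.
  vertex : ∀ i, s.arr 3 i < n

/-- From `s` to `s'` at most `k` cells are pushed, and registers from `L` on do not change. -/
structure Extends (L k : ℕ) (s s' : RAMState) : Prop where
  le_top : s.reg 20 ≤ s'.reg 20
  top_le : s'.reg 20 ≤ s.reg 20 + k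
  cell : ∀ i < s.reg 20, s'.arr 3 i = s.arr 3 i
  reg : ∀ r, L ≤ r → s'.reg r = s.reg r

theorem Extends.trans {L L' L'' k k' : ℕ} {s s' s'' : RAMState} (h : Extends L k s s')
    (h' : Extends L' k' s' s'') (hL : L ≤ L'') (hL' : L' ≤ L'') :
    Extends L'' (k + k') s s'' := by
  refine ⟨h.le_top.trans h'.le_top, ?_, fun i hi => ?_, fun r hr => ?_⟩
  · have := h.top_le
    have := h'.top_le
    omega
  · rw [h'.cell i (hi.trans_le h.le_top), h.cell i hi]
  · rw [h'.reg r (by omega), h.reg r (by omega)]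

theorem Extends.mono {L L' k k' : ℕ} {s s' : RAMState} (h : Extends L k s s')
    (hL : L ≤ L') (hk : k ≤ k') : Extends L' k' s s' :=
  ⟨h.le_top, by have := h.top_le; omega, h.cell, fun r hr => h.reg r (by omega)⟩

theorem SameOutside.extends {s s' : RAMState} (h : SameOutside s s') : Extends 30 0 s s' :=
  ⟨(h.reg 20 (by omega)).ge, (h.reg 20 (by omega)).le, fun i _ => by rw [h.arr],
    fun r hr => h.reg r (by omega)⟩

theorem SameOutside.ready {n : ℕ} {off nbr : ℕ → ℕ} {s s' : RAMState} (h : SameOutside s s')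
    (hs : Ready n off nbr s) : Ready n off nbr s' :=
  ⟨h.hasInput hs.toHasInput, h.arr ▸ hs.vertex⟩

section Search

variable {n : ℕ} {G : SimpleGraph (Fin n)} {off nbr : ℕ → ℕ}

/-- The marked vertices are those in `M`. -/
def Marks (M : Finset (Fin n)) (s : RAMState) : Prop :=
  ∀ v : Fin n, s.arr 2 v = if v ∈ M then 1 else 0

/-- The vertex `x` is on the stack. -/
def Stacked (x : Fin n) (s : RAMState) : Prop :=
  ∃ i < s.reg 20, s.arr 3 i = x

/-- Every small set that contains `M` misses a path on three vertices on the stack. -/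
def Blocked (G : SimpleGraph (Fin n)) (M : Finset (Fin n)) (s : RAMState) : Prop :=
  ∀ A, M ⊆ A → IsSmall G A → ∃ Q, IsP3Set G Q ∧ Disjoint A Q ∧ ∀ x ∈ Q, Stacked x s

/-- The answer `yes` has been found. -/
def Success (G : SimpleGraph (Fin n)) (s : RAMState) : Prop :=
  s.reg 1 = 1 ∧ ∃ A, Marks A s ∧ IsMTSet G A

theorem Stacked.extends {x : Fin n} {s s' : RAMState} {L k : ℕ} (h : Stacked x s)
    (hs : Extends L k s s') : Stacked x s' := by
  obtain ⟨i, hi, hx⟩ := h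
  exact ⟨i, hi.trans_le hs.le_top, (hs.cell i hi).trans hx⟩

theorem Blocked.extends {M : Finset (Fin n)} {s s' : RAMState} {L k : ℕ} (h : Blocked G M s)
    (hs : Extends L k s s') : Blocked G M s' := by
  intro A hMA hA
  obtain ⟨Q, h1, h2, h3⟩ := h A hMA hA
  exact ⟨Q, h1, h2, fun x hx => (h3 x hx).extends hs⟩

theorem Marks.le_one {M : Finset (Fin n)} {s : RAMState} (h : Marks M s) :
    ∀ v < n, s.arr 2 v ≤ 1 := by
  intro v hv
  rw [h ⟨v, hv⟩]
  split <;> omega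

theorem Marks.eq_zero_iff {M : Finset (Fin n)} {s : RAMState} (h : Marks M s) (v : Fin n) :
    s.arr 2 v = 0 ↔ v ∉ M := by
  rw [h v]
  split <;> simp_all

theorem Marks.eq_one_iff {M : Finset (Fin n)} {s : RAMState} (h : Marks M s) (v : Fin n) :
    s.arr 2 v = 1 ↔ v ∈ M := by
  rw [h v]
  split <;> simp_all

variable {W : ℕ} {s : RAMState}

theorem wp_pushP3 (hW : 3 * n + 200 ≤ W) (hs : Ready n off nbr s) (h20 : s.reg 20 ≤ 117)
    {a b c : Fin n} (ha : s.reg 16 = a) (hb : s.reg 17 = b) (hc : s.reg 18 = c) :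
    wp W pushP3 s fun t s' => t ≤ 7 ∧ Ready n off nbr s' ∧ Extends 30 3 s s' ∧
      Stacked a s' ∧ Stacked b s' ∧ Stacked c s' ∧ s'.arr 2 = s.arr 2 ∧
      ∀ r < 19, s'.reg r = s.reg r := by
  have hpush : ∀ (s : RAMState) (x v : ℕ), (s.setArr 3 x v).arr 0 = s.arr 0 ∧
      (s.setArr 3 x v).arr 1 = s.arr 1 ∧ (s.setArr 3 x v).arr 2 = s.arr 2 := by
    intro s x v
    refine ⟨?_, ?_, ?_⟩ <;> ext i <;> simp [setArr_arr]
  simp +decide only [pushP3, wp_seq, wp_assign, wp_store, Rhs.eval, setReg_reg, setArr_reg,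
    if_true, if_false]
  refine ⟨by omega, by omega, by omega, by omega, trivial, ⟨⟨?_, ?_, ?_⟩, ?_⟩, ⟨?_, ?_, ?_, ?_⟩,
    ⟨s.reg 20, ?_, ?_⟩, ⟨s.reg 20 + 1, ?_, ?_⟩, ⟨s.reg 20 + 1 + 1, ?_, ?_⟩, ?_, ?_⟩
  all_goals try simp +decide only [setReg_reg, setReg_arr, setArr_reg, if_true, if_false, hpush,
    hs.reg_zero, hs.arr_zero, hs.arr_one, setArr_arr, true_and]
  · intro i
    have := hs.vertex i
    split_ifs <;> omega
  · omega
  · omega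
  · intro i hi
    rw [if_neg (by omega), if_neg (by omega), if_neg (by omega)]
  · intro r hr
    rw [if_neg (by omega), if_neg (by omega), if_neg (by omega), if_neg (by omega)]
  · omega
  · rw [if_neg (by omega), if_neg (by omega), ha]
  · omega
  · rw [if_neg (by omega), hb]
  · omega
  · exact hc
  · intro r hr
    rw [if_neg (by omega), if_neg (by omega), if_neg (by omega), if_neg (by omega)]

/-- The capacity of the stack needed by `search d`. -/
def stackUse : ℕ → ℕ
  | 0 => 3
  | d + 1 => 3 + 3 * stackUse d

/-- The running time of `search d`, divided by `n`. -/
def searchCost : ℕ → ℕ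
  | 0 => 200
  | d + 1 => 200 + 3 * searchCost d

/-- The specification of `search d`, when started in state `s` with the vertices in `M` marked. -/
def SearchPost (G : SimpleGraph (Fin n)) (off nbr : ℕ → ℕ) (d : ℕ) (M : Finset (Fin n))
    (s : RAMState) (t : ℕ) (s' : RAMState) : Prop :=
  t ≤ searchCost d * n ∧ Ready n off nbr s' ∧ Extends (30 + 3 * d) (stackUse d) s s' ∧
    (Success G s' ∨ s'.reg 1 = 0 ∧ Marks M s' ∧ Blocked G M s')

/-- After a success the mark on `x` stays, as the marks are the output; otherwise unmarking restores
`M`. The conjunct `s.reg 1 = 0` in the failure case lets a failure of the last of three branches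
show that the earlier ones failed too. -/
theorem wp_branch {d : ℕ} {M : Finset (Fin n)}
    (hsearch : ∀ x ∉ M, ∀ s, Ready n off nbr s → s.reg 1 = 0 → Marks (insert x M) s →
      s.reg 20 + stackUse d ≤ 120 → wp W (search d) s (SearchPost G off nbr d (insert x M) s))
    (hW : 3 * n + 200 ≤ W) (hs : Ready n off nbr s) (h1 : Success G s ∨ s.reg 1 = 0 ∧ Marks M s)
    {r : ℕ} (hr : 30 + 3 * d ≤ r) {x : Fin n} (hx : s.reg r = x) (hxM : x ∉ M)
    (h20 : s.reg 20 + stackUse d ≤ 120) :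
    wp W (branch (search d) r) s fun t s' => t ≤ searchCost d * n + 10 ∧ Ready n off nbr s' ∧
      Extends (30 + 3 * d) (stackUse d) s s' ∧
      (Success G s' ∨ s.reg 1 = 0 ∧ s'.reg 1 = 0 ∧ Marks M s' ∧ Blocked G (insert x M) s') := by
  have hr19 : r ≠ 19 := by omega
  simp +decide only [branch, wp_seq, wp_assign, wp_ite, wp_skip, wp_store, Rhs.eval, setReg_reg,
    RAMTest.Holds, if_true, if_false, hr19, hx]
  refine ⟨by omega, fun h => ⟨by omega, ?_⟩, fun h => ?_⟩
  · have hM := (h1.resolve_left (fun h' => by have := h'.1; omega)).2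
    refine wp_mono (hsearch x hxM _ ?_ ?_ ?_ ?_) ?_
    · refine ⟨⟨?_, ?_, ?_⟩, ?_⟩
      · simpa +decide only [setReg_reg, setArr_reg, if_false] using hs.reg_zero
      · ext i
        simp +decide only [setArr_arr, setReg_arr, hs.arr_zero, false_and, if_false]
      · ext i
        simp +decide only [setArr_arr, setReg_arr, hs.arr_one, false_and, if_false]
      · simpa +decide only [setArr_arr, setReg_arr, false_and, if_false] using hs.vertex
    · simpa +decide only [setReg_reg, setArr_reg, if_false] using h
    · intro v
      have := hM v
      simp only [setArr_arr, setReg_arr, true_and, Finset.mem_insert, Fin.val_inj]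
      by_cases hvx : v = x <;> simp [hvx, this]
    · simpa +decide only [setReg_reg, setArr_reg, if_false] using h20
    · rintro t s' ⟨ht, hready, hext, hpost⟩
      have hext' : Extends (30 + 3 * d) (stackUse d) s s' := by
        have h1 := hext.le_top
        have h2 := hext.top_le
        have h3 := hext.cell
        have h4 := hext.reg
        simp +decide only [setReg_reg, setArr_reg, setArr_arr, setReg_arr, if_false,
          false_and] at h1 h2 h3 h4
        refine ⟨h1, h2, h3, fun r hr => ?_⟩
        rw [h4 r hr, if_neg (by omega), if_neg (by omega)]
      refine ⟨by omega, fun h0 => ⟨by omega, ?_, ?_, .inr ?_⟩, fun h0 => ⟨by omega, ?_, ?_, ?_⟩⟩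
      · refine ⟨⟨?_, ?_, ?_⟩, ?_⟩
        · simpa +decide only [setReg_reg, setArr_reg, if_false] using hready.reg_zero
        · ext i
          simp +decide only [setArr_arr, setReg_arr, hready.arr_zero, false_and, if_false]
        · ext i
          simp +decide only [setArr_arr, setReg_arr, hready.arr_one, false_and, if_false]
        · simpa +decide only [setArr_arr, setReg_arr, false_and, if_false] using hready.vertex
      · refine ⟨?_, ?_, ?_, fun q hq => ?_⟩
        · simpa +decide only [setReg_reg, setArr_reg, if_false] using hext'.le_top
        · simpa +decide only [setReg_reg, setArr_reg, if_false] using hext'.top_le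
        · simpa +decide only [setArr_arr, setReg_arr, false_and, if_false] using hext'.cell
        · rw [setArr_reg, setReg_reg, if_neg (by omega), hext'.reg q hq]
      · obtain ⟨-, hmarks, hblocked⟩ := hpost.resolve_left (fun h' => by have := h'.1; omega)
        refine ⟨h, ?_, ?_, ?_⟩
        · simpa +decide only [setReg_reg, setArr_reg, if_false] using h0
        · intro v
          have hxr : s'.reg r = x := by rw [hext'.reg r hr, hx]
          have := hmarks v
          simp only [setArr_arr, setReg_arr, true_and, hxr, Fin.val_inj]
          by_cases hvx : v = x <;> simp_all
        · intro A hA hA'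
          obtain ⟨Q, h2, h3, h4⟩ := hblocked A hA hA'
          refine ⟨Q, h2, h3, fun y hy => ?_⟩
          obtain ⟨i, hi, hy⟩ := h4 y hy
          refine ⟨i, ?_, ?_⟩
          · simpa +decide only [setReg_reg, setArr_reg, if_false] using hi
          · simpa +decide only [setArr_arr, setReg_arr, false_and, if_false] using hy
      · exact ⟨⟨(by simpa +decide only [setReg_reg, if_false] using hready.reg_zero),
          hready.arr_zero, hready.arr_one⟩, hready.vertex⟩
      · refine ⟨?_, ?_, hext'.cell, fun q hq => ?_⟩
        · simpa +decide only [setReg_reg, if_false] using hext'.le_top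
        · simpa +decide only [setReg_reg, if_false] using hext'.top_le
        · rw [setReg_reg, if_neg (by omega), hext'.reg q hq]
      · rcases hpost with h | h
        · refine .inl ⟨?_, h.2⟩
          simpa +decide only [setReg_reg, if_false] using h.1
        · exact absurd h.1 h0
  · have hS := h1.resolve_right (fun h' => h h'.1)
    refine ⟨by omega, ⟨⟨?_, hs.arr_zero, hs.arr_one⟩, hs.vertex⟩,
      ⟨?_, ?_, fun _ _ => rfl, fun q hq => ?_⟩, .inl ⟨?_, hS.2⟩⟩
    · simpa +decide only [setReg_reg, if_false] using hs.reg_zero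
    · simp +decide only [setReg_reg, if_false, le_refl]
    · simp +decide only [setReg_reg, if_false, Nat.le_add_right]
    · rw [setReg_reg, if_neg (by omega)]
    · simpa +decide only [setReg_reg, if_false] using hS.1

theorem SameOutside.marks {M : Finset (Fin n)} {s s' : RAMState} (h : SameOutside s s')
    (hs : Marks M s) : Marks M s' := by
  intro v
  rw [h.arr, hs v]

/-- Each level adds one vertex to `M`, so the leaves have three marked vertices. Only there can the
marked set fail to be small, which is why only `search 0` first tests whether it is a path. The
vertices branched on at each level sit in registers that the deeper levels leave alone. -/
theorem wp_search (hA : IsAdjacencyList G off nbr) (hL : IsListing n off nbr)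
    (hW : 3 * n + 200 ≤ W) (hn : 1 ≤ n) (d : ℕ) : ∀ (M : Finset (Fin n)) (s : RAMState),
      M.card + d = 3 → Ready n off nbr s → s.reg 1 = 0 → Marks M s →
      s.reg 20 + stackUse d ≤ 120 → wp W (search d) s (SearchPost G off nbr d M s) := by
  induction d with
  | zero =>
    intro M s hM hs h1 hmarks h20
    simp only [search, wp_seq]
    refine wp_mono (wp_findP3 hL hW hs.toHasInput hmarks.le_one le_rfl) ?_
    rintro t s₁ ⟨ht, hs₁, hfound⟩
    simp +decide only [wp_assign, wp_ite, wp_seq, wp_skip, Rhs.eval, RAMTest.Holds, setReg_reg,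
      if_true, if_false]
    refine ⟨by omega, fun h6 => ?_, fun h6 => ?_⟩
    · obtain ⟨a, b, c, habc, ha, hb, hc, -⟩ :=
        (hfound.resolve_right (fun h => by omega)).2.exists_isP3 hA
      rw [hmarks.eq_one_iff] at ha hb hc
      have hMabc : M = {a, b, c} := by
        refine (Finset.eq_of_subset_of_card_le ?_ ?_).symm
        · simp [Finset.insert_subset_iff, *]
        · rw [Finset.card_eq_three.2 ⟨a, b, c, habc.1.ne', habc.2.2, habc.2.1.ne, rfl⟩]
          omega
      have hs₁' := hs₁.setReg (x := 19) (v := 1) (by omega) (by omega)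
      have hmarks₁ := hs₁'.marks hmarks
      refine wp_mono (wp_findP3 hL hW (hs₁'.hasInput hs.toHasInput) hmarks₁.le_one
        (Nat.zero_le _)) ?_
      rintro t' s₂ ⟨ht', hs₂, hfound'⟩
      refine ⟨by omega, fun h6' => ?_, fun h6' => ?_⟩
      · obtain ⟨a', b', c', habc', ha', hb', hc', h16, h17, h18⟩ :=
          (hfound'.resolve_right (fun h => by omega)).2.exists_isP3 hA
        rw [hmarks₁.eq_zero_iff] at ha' hb' hc'
        have hs₂' := (hs₁'.trans hs₂).setReg (x := 19) (v := 1) (by omega) (by omega)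
        have h20' := hs₂'.reg 20 (by omega)
        simp only [stackUse] at h20
        refine wp_mono (wp_pushP3 hW (hs₂'.ready hs) (by omega) (a := a') (b := b') (c := c')
          ?_ ?_ ?_) ?_
        · simpa +decide only [setReg_reg, if_false] using h16
        · simpa +decide only [setReg_reg, if_false] using h17
        · simpa +decide only [setReg_reg, if_false] using h18
        · rintro t'' s₃ ⟨ht'', hready, hext, hsa, hsb, hsc, harr, hreg⟩
          refine ⟨?_, hready,
            (hs₂'.extends.trans hext le_rfl le_rfl).mono le_rfl (by simp [stackUse]),
            .inr ⟨?_, ?_, ?_⟩⟩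
          · simp only [searchCost]
            omega
          · rw [hreg 1 (by omega), hs₂'.reg 1 (by omega), h1]
          · intro v
            rw [harr]
            exact hs₂'.marks hmarks v
          · intro A hMA hAs
            -- Small sets have at most three vertices, so `M` itself is the only small set
            -- containing it.
            have hAM : M = A := by
              refine Finset.eq_of_subset_of_card_le hMA ?_
              rcases hAs with h | ⟨x, y, z, -, rfl⟩
              · omega
              · exact Finset.card_le_three.trans (by omega)
            subst hAM
            refine ⟨{a', b', c'}, ⟨a', b', c', habc', rfl⟩, ?_, ?_⟩
            · rw [Finset.disjoint_right]
              simp [ha', hb', hc']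
            · simp [*]
      · have hno := (hfound'.resolve_left (fun h => h6' h.1)).2
        have hs₂' := (hs₁'.trans hs₂).setReg (x := 19) (v := 1) (by omega) (by omega)
        have hready := hs₂'.ready hs
        have hext := hs₂'.extends
        refine ⟨by omega, ?_, ⟨⟨?_, hready.arr_zero, hready.arr_one⟩, hready.vertex⟩, ?_,
          .inl ⟨?_, M, hs₂'.marks hmarks, ?_, ?_⟩⟩
        · simp only [searchCost]
          omega
        · simpa +decide only [setReg_reg, if_false] using hready.reg_zero
        · refine ⟨?_, ?_, hext.cell, fun r hr => ?_⟩
          · simpa +decide only [setReg_reg, if_false] using hext.le_top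
          · have := hext.top_le
            simp +decide only [setReg_reg, if_false] at this ⊢
            omega
          · rw [setReg_reg, if_neg (by omega), hext.reg r (by omega)]
        · simp only [setReg_reg, if_true]
        · exact IsSmall.adj_or_adj (.inr ⟨a, b, c, habc, hMabc⟩)
        · intro x hx y hy z hz
          exact not_isP3_of_noP3At hA hno ((hmarks₁.eq_zero_iff x).2 hx)
            ((hmarks₁.eq_zero_iff y).2 hy) ((hmarks₁.eq_zero_iff z).2 hz)
    · have hno := (hfound.resolve_left (fun h => h6 h.1)).2
      have hs₁' := hs₁.setReg (x := 19) (v := 1) (by omega) (by omega)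
      refine ⟨?_, hs₁'.ready hs, hs₁'.extends.mono le_rfl (Nat.zero_le _), .inr ⟨?_, ?_, ?_⟩⟩
      · simp only [searchCost]
        omega
      · rw [hs₁'.reg 1 (by omega), h1]
      · exact hs₁'.marks hmarks
      -- Three marked vertices that do not form a path lie in no small set, so being blocked is
      -- vacuous.
      · intro A hMA hAs
        exfalso
        rcases hAs with h | ⟨x, y, z, hxyz, rfl⟩
        · have := Finset.card_le_card hMA
          omega
        · have hAM : M = {x, y, z} :=
            Finset.eq_of_subset_of_card_le hMA (Finset.card_le_three.trans (by omega))
          refine not_isP3_of_noP3At hA hno ((hmarks.eq_one_iff x).2 ?_)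
            ((hmarks.eq_one_iff y).2 ?_) ((hmarks.eq_one_iff z).2 ?_) hxyz <;> simp [hAM]
  | succ d ih =>
    intro M s hM hs h1 hmarks h20
    simp only [search, wp_seq]
    refine wp_mono (wp_findP3 hL hW hs.toHasInput hmarks.le_one (Nat.zero_le _)) ?_
    rintro t s₁ ⟨ht, hs₁, hfound⟩
    have hs₁' := hs₁.setReg (x := 19) (v := 1) (by omega) (by omega)
    have hready₁ := hs₁'.ready hs
    have hext₁ := hs₁'.extends
    have hmarks₁ := hs₁'.marks hmarks
    simp +decide only [wp_assign, wp_ite, wp_seq, Rhs.eval, RAMTest.Holds, setReg_reg,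
      if_true, if_false]
    refine ⟨by omega, fun h6 => ?_, fun h6 => ?_⟩
    · obtain ⟨a, b, c, habc, ha, hb, hc, h16, h17, h18⟩ :=
        (hfound.resolve_right (fun h => by omega)).2.exists_isP3 hA
      rw [hmarks.eq_zero_iff] at ha hb hc
      simp only [stackUse] at h20
      have hsearch : ∀ x ∉ M, ∀ s, Ready n off nbr s → s.reg 1 = 0 → Marks (insert x M) s →
          s.reg 20 + stackUse d ≤ 120 →
            wp W (search d) s (SearchPost G off nbr d (insert x M) s) := by
        intro x hx s
        refine ih (insert x M) s ?_
        rw [Finset.card_insert_of_notMem hx]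
        omega
      have h20₁ := hs₁'.reg 20 (by omega)
      refine wp_mono (wp_pushP3 hW hready₁ (by omega) (a := a) (b := b) (c := c) ?_ ?_ ?_) ?_
      · simpa +decide only [setReg_reg, if_false] using h16
      · simpa +decide only [setReg_reg, if_false] using h17
      · simpa +decide only [setReg_reg, if_false] using h18
      rintro t₂ s₂ ⟨ht₂, hready₂, hext₂, hsa, hsb, hsc, harr, hreg⟩
      have r16 : s₂.reg 16 = a := by
        rw [hreg 16 (by omega), setReg_reg, if_neg (by omega), h16]
      have r17 : s₂.reg 17 = b := by
        rw [hreg 17 (by omega), setReg_reg, if_neg (by omega), h17]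
      have r18 : s₂.reg 18 = c := by
        rw [hreg 18 (by omega), setReg_reg, if_neg (by omega), h18]
      have e1 : 17 ≠ 30 + 3 * d := by omega
      have e2 : 18 ≠ 30 + 3 * d := by omega
      have e3 : 18 ≠ 31 + 3 * d := by omega
      simp only [if_neg e1, if_neg e2, if_neg e3, r16, r17, r18]
      refine ⟨by omega, by omega, by omega, ?_⟩
      set s₃ := ((s₂.setReg (30 + 3 * d) a).setReg (31 + 3 * d) b).setReg (32 + 3 * d) c with hs₃
      have hlow : ∀ r < 30, s₃.reg r = s₂.reg r := by
        intro r hr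
        rw [hs₃, setReg_reg, if_neg (by omega), setReg_reg, if_neg (by omega), setReg_reg,
          if_neg (by omega)]
      have hready₃ : Ready n off nbr s₃ :=
        ⟨⟨(hlow 0 (by omega)).trans hready₂.reg_zero, hready₂.arr_zero, hready₂.arr_one⟩,
          hready₂.vertex⟩
      have hext₂₃ : Extends (33 + 3 * d) 0 s₂ s₃ := by
        refine ⟨(hlow 20 (by omega)).ge, (hlow 20 (by omega)).le, fun _ _ => rfl, fun r hr => ?_⟩
        rw [hs₃, setReg_reg, if_neg (by omega), setReg_reg, if_neg (by omega), setReg_reg,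
          if_neg (by omega)]
      have hext₃ : Extends (33 + 3 * d) 3 s s₃ :=
        ((hext₁.trans hext₂ le_rfl le_rfl).trans hext₂₃ (by omega) le_rfl).mono le_rfl (by omega)
      have h1₃ : s₃.reg 1 = 0 := by
        rw [hlow 1 (by omega), hreg 1 (by omega), hs₁'.reg 1 (by omega), h1]
      have hmarks₃ : Marks M s₃ := by
        intro v
        rw [← hmarks₁ v, ← harr, hs₃, setReg_arr, setReg_arr, setReg_arr]
      have ra : s₃.reg (30 + 3 * d) = a := by
        rw [hs₃, setReg_reg, if_neg (by omega), setReg_reg, if_neg (by omega), setReg_reg,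
          if_pos rfl]
      have rb : s₃.reg (31 + 3 * d) = b := by
        rw [hs₃, setReg_reg, if_neg (by omega), setReg_reg, if_pos rfl]
      have rc : s₃.reg (32 + 3 * d) = c := by
        rw [hs₃, setReg_reg, if_pos rfl]
      have t₃ := hext₃.top_le
      refine wp_mono (wp_branch hsearch hW hready₃ (.inr ⟨h1₃, hmarks₃⟩) le_rfl ra ha
        (by omega)) ?_
      rintro t₄ s₄ ⟨ht₄, hready₄, hext₄, hpost₄⟩
      have t₄ := hext₄.top_le
      refine wp_mono (wp_branch hsearch hW hready₄ (hpost₄.imp_right fun h => ⟨h.2.1, h.2.2.1⟩)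
        (by omega) ((hext₄.reg _ (by omega)).trans rb) hb (by omega)) ?_
      rintro t₅ s₅ ⟨ht₅, hready₅, hext₅, hpost₅⟩
      have t₅ := hext₅.top_le
      refine wp_mono (wp_branch hsearch hW hready₅ (hpost₅.imp_right fun h => ⟨h.2.1, h.2.2.1⟩)
        (by omega) ((hext₅.reg _ (by omega)).trans ((hext₄.reg _ (by omega)).trans rc)) hc
        (by omega)) ?_
      rintro t₆ s₆ ⟨ht₆, hready₆, hext₆, hpost₆⟩
      have hext₅₆ := hext₅.trans hext₆ le_rfl le_rfl
      have hext₃₆ := hext₄.trans hext₅₆ le_rfl le_rfl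
      refine ⟨?_, hready₆, (hext₃.trans hext₃₆ (L'' := 30 + 3 * (d + 1)) (by omega)
        (by omega)).mono le_rfl (by simp only [stackUse]; omega), ?_⟩
      · simp only [searchCost, add_mul, mul_assoc]
        omega
      rcases hpost₆ with h | ⟨h1₅, h1₆, hmarks₆, hblock₆⟩
      · exact .inl h
      obtain ⟨h1₄, -, -, hblock₅⟩ := hpost₅.resolve_left fun h => by
        have := h.1
        omega
      obtain ⟨-, -, -, hblock₄⟩ := hpost₄.resolve_left fun h => by
        have := h.1
        omega
      refine .inr ⟨h1₆, hmarks₆, fun A hMA hAs => ?_⟩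
      -- Either `A` contains a vertex of the path found here and the corresponding branch blocks it,
      -- or `A` misses this path, which is itself on the stack.
      by_cases haA : a ∈ A
      · exact hblock₄.extends hext₅₆ A (Finset.insert_subset haA hMA) hAs
      by_cases hbA : b ∈ A
      · exact hblock₅.extends hext₆ A (Finset.insert_subset hbA hMA) hAs
      by_cases hcA : c ∈ A
      · exact hblock₆ A (Finset.insert_subset hcA hMA) hAs
      have hext₂₆ := hext₂₃.trans hext₃₆ le_rfl (by omega)
      refine ⟨{a, b, c}, ⟨a, b, c, habc, rfl⟩, ?_, ?_⟩
      · rw [Finset.disjoint_right]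
        simp [haA, hbA, hcA]
      · simp [hsa.extends hext₂₆, hsb.extends hext₂₆, hsc.extends hext₂₆]
    · have hno := (hfound.resolve_left (fun h => h6 h.1)).2
      refine ⟨by omega, ?_, ⟨⟨?_, hready₁.arr_zero, hready₁.arr_one⟩, hready₁.vertex⟩, ?_,
          .inl ⟨?_, M, hmarks₁, ?_, ?_⟩⟩
      · simp only [searchCost, add_mul]
        omega
      · simpa +decide only [setReg_reg, if_false] using hready₁.reg_zero
      · refine ⟨?_, ?_, hext₁.cell, fun r hr => ?_⟩
        · simpa +decide only [setReg_reg, if_false] using hext₁.le_top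
        · have := hext₁.top_le
          simp +decide only [setReg_reg, if_false] at this ⊢
          omega
        · rw [setReg_reg, if_neg (by omega), hext₁.reg r (by omega)]
      · simp only [setReg_reg, if_true]
      · exact IsSmall.adj_or_adj (.inl (by omega))
      · intro x hx y hy z hz
        exact not_isP3_of_noP3At hA hno ((hmarks.eq_zero_iff x).2 hx)
          ((hmarks.eq_zero_iff y).2 hy) ((hmarks.eq_zero_iff z).2 hz)

end Search

/-! ### Finding an obstruction among the vertices on the stack -/

/-- Runs `p a` for all `a` in `l`, one after the other. -/
def forEach {α : Type*} (l : List α) (p : α → RAMProg) : RAMProg :=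
  l.foldr (fun a q => p a ;; q) .skip

theorem wp_forEach {α : Type*} {W : ℕ} {l : List α} {p : α → RAMProg} {s : RAMState}
    {I : RAMState → Prop} {D : α → RAMState → Prop} {c : ℕ} (hs : I s)
    (hp : ∀ a ∈ l, ∀ s, I s →
      wp W (p a) s fun t s' => t ≤ c ∧ I s' ∧ D a s' ∧ ∀ b, D b s → D b s') :
    wp W (forEach l p) s fun t s' => t ≤ l.length * c + 1 ∧ I s' ∧ ∀ a ∈ l, D a s' := by
  suffices H : wp W (forEach l p) s fun t s' =>
      t ≤ l.length * c + 1 ∧ I s' ∧ (∀ a ∈ l, D a s') ∧ ∀ b, D b s → D b s' from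
    wp_mono H fun t s' h => ⟨h.1, h.2.1, h.2.2.1⟩
  induction l generalizing s with
  | nil => simpa [forEach, wp_skip] using hs
  | cons a l ih =>
    change wp W (p a ;; forEach l p) s _
    rw [wp_seq]
    refine wp_mono (hp a (by simp) s hs) ?_
    rintro t s₁ ⟨ht, hI₁, hD₁, hst₁⟩
    refine wp_mono (ih hI₁ fun a ha => hp a (by simp [ha])) ?_
    rintro t' s₂ ⟨ht', hI₂, hD₂, hst₂⟩
    refine ⟨?_, hI₂, ?_, fun b hb => hst₂ b (hst₁ b hb)⟩
    · rw [List.length_cons, add_mul]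
      omega
    · intro b hb
      rcases List.mem_cons.1 hb with rfl | hb
      · exact hst₂ _ hD₁
      · exact hD₂ b hb

/-- Loads the stack cells `τ 0, …, τ 8` into the registers `50, …, 58`. -/
def loadTuple (τ : Fin 9 → Fin 120) : RAMProg :=
  forEach (List.finRange 9) fun i =>
    .assign 19 (.const (τ i)) ;; .assign (50 + i) (.load 3 19)

/-- Sets register `40` to `0` if registers `50 + i` and `50 + j` are not as in the obstruction with
index `k`. -/
def testPair (k : Fin 11) (e : Fin 9 × Fin 9) : RAMProg :=
  testAdj (50 + e.1) (50 + e.2) ;;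
  .assign 19 (.const (if hasEdge (edges3P3 ++ addedEdges k) e.1 e.2 then 1 else 0)) ;;
  .ite (.eq 6 19)
    (if e.1 = e.2 then .skip else .ite (.eq (50 + e.1) (50 + e.2)) (.assign 40 (.const 0)) .skip)
    (.assign 40 (.const 0))

/-- Sets register `40` to `1` or `0`, according to whether the stack cells `τ 0, …, τ 8` form an
induced copy of the obstruction with index `k`. -/
def testTuple (k : Fin 11) (τ : Fin 9 → Fin 120) : RAMProg :=
  loadTuple τ ;; .assign 40 (.const 1) ;;
    forEach (List.finRange 9 ×ˢ List.finRange 9) (testPair k)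

/-- Outputs the registers `50, …, 58` and the index `k`. -/
def writeCopy (k : Fin 11) : RAMProg :=
  .assign 2 (.const k) ;;
    forEach (List.finRange 9) fun i => .assign 19 (.const i) ;; .store 2 19 (50 + i)

/-- Outputs the first tuple in the list that forms an induced copy of an obstruction. -/
def findCopy : List (Fin 11 × (Fin 9 → Fin 120)) → RAMProg
  | [] => .skip
  | (k, τ) :: l =>
    testTuple k τ ;; .assign 19 (.const 1) ;; .ite (.eq 40 19) (writeCopy k) (findCopy l)

section FindCopy

variable {n : ℕ} {G : SimpleGraph (Fin n)} {off nbr : ℕ → ℕ} {W : ℕ} {s : RAMState}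

/-- The stack cells `τ 0, …, τ 8` form an induced copy of the obstruction with index `k`. -/
def IsCopy (G : SimpleGraph (Fin n)) (arr : ℕ → ℕ) (k : Fin 11) (τ : Fin 9 → Fin 120) : Prop :=
  ∃ f : forestObstruction k ↪g G, ∀ i, arr (τ i) = f i

/-- The pair `e` is as in the obstruction with index `k`. -/
def PairFits (G : SimpleGraph (Fin n)) (v : Fin 9 → Fin n) (k : Fin 11) (e : Fin 9 × Fin 9) :
    Prop :=
  (G.Adj (v e.1) (v e.2) ↔ hasEdge (edges3P3 ++ addedEdges k) e.1 e.2 = true) ∧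
    (v e.1 = v e.2 → e.1 = e.2)

theorem isCopy_iff {arr : ℕ → ℕ} {v : Fin 9 → Fin n} {k : Fin 11} {τ : Fin 9 → Fin 120}
    (hv : ∀ i, arr (τ i) = v i) : IsCopy G arr k τ ↔ ∀ e, PairFits G v k e := by
  constructor
  · rintro ⟨f, hf⟩ e
    have hfv : ∀ i, v i = f i := fun i => Fin.val_injective ((hv i).symm.trans (hf i))
    refine ⟨?_, fun h => ?_⟩
    · rw [hfv, hfv, f.map_adj_iff, forestObstruction_adj]
    · rw [hfv, hfv] at h
      exact f.injective h
  · intro h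
    exact ⟨⟨⟨v, fun i j hij => (h (i, j)).2 hij⟩, fun {i j} => (h (i, j)).1.trans
      forestObstruction_adj.symm⟩, hv⟩

theorem wp_loadTuple (hW : 3 * n + 200 ≤ W) (hs : Ready n off nbr s) (τ : Fin 9 → Fin 120) :
    wp W (loadTuple τ) s fun t s' => t ≤ 19 ∧ s'.arr = s.arr ∧ s'.reg 0 = s.reg 0 ∧
      s'.reg 1 = s.reg 1 ∧ ∀ i : Fin 9, s'.reg (50 + i) = s.arr 3 (τ i) := by
  refine wp_mono (wp_forEach (c := 2) (I := fun s' => s'.arr = s.arr ∧ s'.reg 0 = s.reg 0 ∧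
    s'.reg 1 = s.reg 1) (D := fun (i : Fin 9) s' => s'.reg (50 + i) = s.arr 3 (τ i))
    ⟨rfl, rfl, rfl⟩ ?_) ?_
  · rintro i - s' ⟨harr, h0, h1⟩
    have h2 := hs.vertex (τ i)
    have h3 := (τ i).2
    simp +decide only [wp_seq, wp_assign, Rhs.eval, setReg_reg, setReg_arr, harr, if_true,
      if_false]
    refine ⟨by omega, by omega, trivial, ⟨trivial, ?_, ?_⟩, trivial, fun j hj => ?_⟩
    · rw [if_neg (by omega), h0]
    · rw [if_neg (by omega), h1]
    · by_cases hij : j = i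
      · rw [hij, if_pos rfl]
      · have : j.val ≠ i.val := fun h => hij (Fin.ext h)
        rw [if_neg (by omega), if_neg (by omega), hj]
  · rintro t s' ⟨ht, ⟨h1, h2, h3⟩, h4⟩
    exact ⟨by simpa using ht, h1, h2, h3, fun i => h4 i (List.mem_finRange i)⟩

theorem wp_testTuple (hA : IsAdjacencyList G off nbr) (hL : IsListing n off nbr)
    (hW : 3 * n + 200 ≤ W) (hs : Ready n off nbr s) (k : Fin 11) (τ : Fin 9 → Fin 120) :
    wp W (testTuple k τ) s fun t s' => t ≤ 1620 * n + 3000 ∧ s'.arr = s.arr ∧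
      s'.reg 0 = s.reg 0 ∧ s'.reg 1 = s.reg 1 ∧
      (∀ i : Fin 9, s'.reg (50 + i) = s.arr 3 (τ i)) ∧
      (s'.reg 40 = 1 ↔ IsCopy G (s.arr 3) k τ) := by
  rw [testTuple, wp_seq]
  refine wp_mono (wp_loadTuple hW hs τ) ?_
  rintro t s₁ ⟨ht, harr₁, h0₁, h1₁, hreg₁⟩
  simp only [wp_seq, wp_assign, Rhs.eval]
  refine ⟨by omega, ?_⟩
  let v : Fin 9 → Fin n := fun i => ⟨s.arr 3 (τ i), hs.vertex _⟩
  have hv : ∀ i, s.arr 3 (τ i) = v i := fun _ => rfl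
  -- Register `40` only ever drops from 1 to 0, so the implication recorded for each pair persists
  -- through later tests.
  refine wp_mono (wp_forEach (c := 20 * n + 30)
    (I := fun s' => s'.arr = s.arr ∧ s'.reg 0 = s.reg 0 ∧ s'.reg 1 = s.reg 1 ∧
      (∀ i : Fin 9, s'.reg (50 + i) = v i) ∧ ((∀ e, PairFits G v k e) → s'.reg 40 = 1))
    (D := fun e s' => s'.reg 40 = 1 → PairFits G v k e) ?_ ?_) ?_
  · refine ⟨harr₁, ?_, ?_, fun i => ?_, ?_⟩
    · rw [setReg_reg, if_neg (by omega), h0₁]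
    · rw [setReg_reg, if_neg (by omega), h1₁]
    · rw [setReg_reg, if_neg (by omega), hreg₁]
    · simp [setReg_reg]
  · rintro ⟨i, j⟩ - s₂ ⟨harr, h0, h1, hreg, h40⟩
    have hs₂ : HasInput n off nbr s₂ :=
      ⟨h0.trans hs.reg_zero, harr ▸ hs.arr_zero, harr ▸ hs.arr_one⟩
    rw [testPair, wp_seq]
    refine wp_mono (wp_testAdj hL hW hs₂ (by omega) ?_ ?_) ?_
    · rw [hreg]
      exact (v i).2
    · rw [hreg]
      exact (v j).2
    rintro t₃ s₃ ⟨ht₃, hsame, h6, h6'⟩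
    have hadj : s₃.reg 6 = 1 ↔ G.Adj (v i) (v j) := by
      rw [h6', hA.adj_iff, hreg, hreg]
    have hr : ∀ i : Fin 9, s₃.reg (50 + i) = v i := fun i => by
      rw [hsame.reg _ (by omega), hreg]
    have h0' : s₃.reg 0 = s.reg 0 := by rw [hsame.reg _ (by omega), h0]
    have h1' : s₃.reg 1 = s.reg 1 := by rw [hsame.reg _ (by omega), h1]
    have h40' : s₃.reg 40 = s₂.reg 40 := hsame.reg _ (by omega)
    have harr' : s₃.arr = s.arr := by rw [hsame.arr, harr]
    obtain ⟨x, hx⟩ : ∃ x, x = if hasEdge (edges3P3 ++ addedEdges k) i j = true then 1 else 0 :=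
      ⟨_, rfl⟩
    have hx1 : x ≤ 1 := by
      rw [hx]
      split <;> omega
    have h6x : s₃.reg 6 = x ↔
        (G.Adj (v i) (v j) ↔ hasEdge (edges3P3 ++ addedEdges k) i j = true) := by
      rw [← hadj, hx]
      rcases h6 with h | h <;> by_cases hE : hasEdge (edges3P3 ++ addedEdges k) i j = true <;>
        simp [h, hE]
    have hrest : ∀ Q : ℕ → RAMState → Prop,
        (∀ t ≤ 10, PairFits G v k (i, j) → Q t (s₃.setReg 19 x)) →
        (∀ t ≤ 10, ¬ PairFits G v k (i, j) → Q t ((s₃.setReg 19 x).setReg 40 0)) →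
        wp W (.assign 19 (.const x) ;; .ite (.eq 6 19)
          (if i = j then .skip else .ite (.eq (50 + i) (50 + j)) (.assign 40 (.const 0)) .skip)
          (.assign 40 (.const 0))) s₃ Q := by
      intro Q hQ hQ'
      simp +decide only [wp_seq, wp_assign, wp_ite, Rhs.eval, RAMTest.Holds, setReg_reg, if_true,
        if_false]
      refine ⟨by omega, fun h => ?_, fun h => ⟨by omega, ?_⟩⟩
      · by_cases hij : i = j
        · rw [if_pos hij, wp_skip]
          exact hQ _ (by omega) ⟨h6x.1 h, fun _ => hij⟩
        · have hni : (50 + i.val) ≠ 19 := by omega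
          have hnj : (50 + j.val) ≠ 19 := by omega
          simp only [if_neg hij, wp_ite, wp_assign, wp_skip, Rhs.eval, RAMTest.Holds, setReg_reg,
            if_neg hni, if_neg hnj, hr, Fin.val_inj]
          exact ⟨fun h' => ⟨by omega, hQ' _ (by omega) fun hp => hij (hp.2 h')⟩,
            fun h' => hQ _ (by omega) ⟨h6x.1 h, fun h => absurd h h'⟩⟩
      · exact hQ' _ (by omega) fun hp => h (h6x.2 hp.1)
    subst hx
    refine hrest _ (fun t ht hp => ?_) fun t ht hp => ?_
    · refine ⟨by omega, ⟨harr', ?_, ?_, fun i => ?_, ?_⟩, fun _ => hp, fun b hb => ?_⟩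
      · rw [setReg_reg, if_neg (by omega), h0']
      · rw [setReg_reg, if_neg (by omega), h1']
      · rw [setReg_reg, if_neg (by omega), hr]
      · rwa [setReg_reg, if_neg (by omega), h40']
      · rwa [setReg_reg, if_neg (by omega), h40']
    · refine ⟨by omega, ⟨harr', ?_, ?_, fun i => ?_, fun h => absurd (h _) hp⟩, ?_, fun b hb => ?_⟩
      · rw [setReg_reg, if_neg (by omega), setReg_reg, if_neg (by omega), h0']
      · rw [setReg_reg, if_neg (by omega), setReg_reg, if_neg (by omega), h1']
      · rw [setReg_reg, if_neg (by omega), setReg_reg, if_neg (by omega), hr]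
      · simp [setReg_reg]
      · simp [setReg_reg]
  · rintro t' s' ⟨ht', ⟨h1, h2, h3, h4, h5⟩, h6⟩
    have hlen : (List.finRange 9 ×ˢ List.finRange 9).length = 81 := by
      rw [List.length_product, List.length_finRange]
    rw [hlen] at ht'
    refine ⟨by omega, h1, h2, h3, h4, ?_⟩
    rw [isCopy_iff hv]
    exact ⟨fun h e => h6 e (List.mem_product.2 ⟨List.mem_finRange _, List.mem_finRange _⟩) h, h5⟩

theorem wp_writeCopy (hW : 3 * n + 200 ≤ W) (h1 : s.reg 1 = 0) {k : Fin 11}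
    {f : forestObstruction k ↪g G} (hf : ∀ i : Fin 9, s.reg (50 + i) = f i) :
    wp W (writeCopy k) s fun t s' => t ≤ 20 ∧ IsNoOutput G s' := by
  simp only [writeCopy, wp_seq, wp_assign, Rhs.eval]
  refine ⟨by omega, ?_⟩
  refine wp_mono (wp_forEach (c := 2) (I := fun s' => s'.reg 1 = 0 ∧ s'.reg 2 = k ∧
    ∀ i : Fin 9, s'.reg (50 + i) = f i) (D := fun (i : Fin 9) s' => s'.arr 2 i = f i) ?_ ?_) ?_
  · refine ⟨?_, ?_, fun i => ?_⟩
    · rw [setReg_reg, if_neg (by omega), h1]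
    · rw [setReg_reg, if_pos rfl]
    · rw [setReg_reg, if_neg (by omega), hf]
  · rintro i - s' ⟨h1, h2, h3⟩
    have hni : (50 + i.val) ≠ 19 := by omega
    simp +decide only [wp_seq, wp_assign, wp_store, Rhs.eval, setReg_reg, setReg_arr, setArr_reg,
      setArr_arr, if_true, if_false, if_neg hni, h3, h1, h2, true_and]
    refine ⟨by omega, fun j => ?_, fun j hj => ?_⟩
    · rw [if_neg (by omega)]
    · split_ifs with h
      · rw [Fin.val_injective h]
      · exact hj
  · rintro t s' ⟨ht, ⟨h1, h2, -⟩, h3⟩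
    have : (List.finRange 9).length = 9 := by simp
    exact ⟨by omega, h1, k, h2, f, fun i => h3 i (List.mem_finRange i)⟩

theorem wp_findCopy (hA : IsAdjacencyList G off nbr) (hL : IsListing n off nbr)
    (hW : 3 * n + 200 ≤ W) (l : List (Fin 11 × (Fin 9 → Fin 120))) :
    ∀ s, Ready n off nbr s → s.reg 1 = 0 → (∃ e ∈ l, IsCopy G (s.arr 3) e.1 e.2) →
      wp W (findCopy l) s fun t s' => t ≤ l.length * (1620 * n + 3030) ∧ IsNoOutput G s' := by
  induction l with
  | nil => simp
  | cons e l ih =>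
    obtain ⟨k, τ⟩ := e
    intro s hs h1 hex
    rw [findCopy, wp_seq]
    refine wp_mono (wp_testTuple hA hL hW hs k τ) ?_
    rintro t s₁ ⟨ht, harr, h0₁, h1₁, hreg, h40⟩
    simp +decide only [wp_seq, wp_assign, wp_ite, Rhs.eval, RAMTest.Holds, setReg_reg, if_true,
      if_false]
    have h1' : (s₁.setReg 19 1).reg 1 = 0 := by
      rw [setReg_reg, if_neg (by omega), h1₁, h1]
    refine ⟨by omega, fun h => ?_, fun h => ?_⟩
    · obtain ⟨f, hf⟩ := h40.1 h
      refine wp_mono (wp_writeCopy hW h1' (f := f) fun i => ?_) ?_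
      · rw [setReg_reg, if_neg (by omega), hreg, hf]
      · rintro t' s' ⟨ht', hno⟩
        refine ⟨?_, hno⟩
        rw [List.length_cons, add_mul]
        omega
    · refine wp_mono (ih (s₁.setReg 19 1) ⟨⟨?_, ?_, ?_⟩, ?_⟩ h1' ?_) ?_
      · rw [setReg_reg, if_neg (by omega), h0₁, hs.reg_zero]
      · rw [setReg_arr, harr, hs.arr_zero]
      · rw [setReg_arr, harr, hs.arr_one]
      · rw [setReg_arr, harr]
        exact hs.vertex
      · obtain ⟨e, he, hcopy⟩ := hex
        rw [setReg_arr, harr]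
        rcases List.mem_cons.1 he with rfl | he
        · exact absurd (h40.2 hcopy) h
        · exact ⟨e, he, hcopy⟩
      · rintro t' s' ⟨ht', hno⟩
        refine ⟨?_, hno⟩
        rw [List.length_cons, add_mul]
        omega

end FindCopy

/-! ### The algorithm -/

/-- All candidates for an induced copy of an obstruction. -/
noncomputable def allTuples : List (Fin 11 × (Fin 9 → Fin 120)) :=
  Finset.univ.toList

/-- The recognition algorithm for Maya-Tupi trees. -/
noncomputable def recognize : RAMProg :=
  search 3 ;; .assign 19 (.const 0) ;; .ite (.eq 1 19) (findCopy allTuples) .skip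

theorem Success.isYesOutput {n : ℕ} {G : SimpleGraph (Fin n)} {s : RAMState} (h : Success G s) :
    IsYesOutput G s := by
  obtain ⟨h1, A, hA, hMT⟩ := h
  have e1 : (Finset.univ.filter fun v : Fin n => s.arr 2 v = 1) = A := by
    ext v
    simp [hA.eq_one_iff]
  have e2 : (Finset.univ.filter fun v : Fin n => s.arr 2 v = 0) = Aᶜ := by
    ext v
    simp [hA.eq_zero_iff]
  refine ⟨h1, ?_⟩
  rw [e1, e2]
  exact isMTPartition_iff.2 ⟨isCompl_compl, hMT⟩

theorem wp_recognize {n : ℕ} {G : SimpleGraph (Fin n)} (hG : G.IsTree) {off nbr : ℕ → ℕ}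
    (hA : IsAdjacencyList G off nbr) {W : ℕ} (hW : 3 * n + 200 ≤ W) :
    wp W recognize (inputState n off nbr) fun t s =>
      t ≤ (searchCost 3 + 10 + allTuples.length * 4650) * n ∧
        (IsMayaTupi G → IsYesOutput G s) ∧ (¬ IsMayaTupi G → IsNoOutput G s) := by
  obtain ⟨r⟩ := hG.connected.nonempty
  have hn : 1 ≤ n := by
    have := r.2
    omega
  have hL := hA.isListing hG
  have hd := isDepth_dist hG r
  have hready : Ready n off nbr (inputState n off nbr) := by
    refine ⟨⟨rfl, rfl, rfl⟩, fun i => ?_⟩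
    simp [inputState]
    omega
  rw [recognize, wp_seq]
  refine wp_mono (wp_search hA hL hW hn 3 ∅ (inputState n off nbr) (by simp) hready rfl ?_ ?_) ?_
  · intro v
    simp [inputState]
  · simp [inputState, stackUse]
  rintro t s ⟨ht, hready', hext, hpost⟩
  simp +decide only [wp_seq, wp_assign, wp_ite, wp_skip, Rhs.eval, RAMTest.Holds, setReg_reg,
    if_true, if_false]
  refine ⟨by omega, fun h1 => ?_, fun h1 => ?_⟩
  · obtain ⟨-, -, hblock⟩ := hpost.resolve_left fun h => by
      have := h.1
      omega
    have hnot : ¬ IsMayaTupi G := by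
      rw [isMayaTupi_iff]
      rintro ⟨A, hA₁, hA₂⟩
      obtain ⟨Q, ⟨a, b, c, habc, rfl⟩, hdisj, -⟩ := hblock A (by simp) (hd.isSmall hA₁)
      rw [Finset.disjoint_right] at hdisj
      exact hA₂ a (hdisj (by simp)) b (hdisj (by simp)) c (hdisj (by simp)) habc
    -- The stacked paths alone witness the failure of every small set, so a copy exists among at
    -- most 120 cells.
    obtain ⟨k, f, hf⟩ := hd.exists_forestObstruction (U := {x | Stacked x s}) fun A hAs => by
      obtain ⟨Q, hQ, hdisj, hst⟩ := hblock A (by simp) hAs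
      exact ⟨Q, hQ, hst, hdisj⟩
    have htop : s.reg 20 ≤ 120 := by
      have := hext.top_le
      simpa [inputState, stackUse] using this
    choose τ hτ hτf using hf
    refine wp_mono (wp_findCopy hA hL hW allTuples (s.setReg 19 0) ⟨⟨?_, ?_, ?_⟩, ?_⟩ ?_
      ⟨(k, fun i => ⟨τ i, (hτ i).trans_le htop⟩), ?_, f, hτf⟩) ?_
    · simpa +decide only [setReg_reg, if_false] using hready'.reg_zero
    · exact hready'.arr_zero
    · exact hready'.arr_one
    · exact hready'.vertex
    · simpa +decide only [setReg_reg, if_false] using h1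
    · simp [allTuples]
    · rintro t' s' ⟨ht', hno⟩
      refine ⟨?_, fun h => absurd h hnot, fun _ => hno⟩
      have : allTuples.length * (1620 * n + 3030) ≤ allTuples.length * (4650 * n) :=
        Nat.mul_le_mul_left _ (by omega)
      rw [add_mul, add_mul, mul_assoc]
      omega
  · have hS := hpost.resolve_right fun h => h1 h.1
    have hyes : Success G (s.setReg 19 0) :=
      ⟨by simpa +decide only [setReg_reg, if_false] using hS.1, hS.2⟩
    refine ⟨?_, fun _ => hyes.isYesOutput, fun h => absurd ?_ h⟩
    · rw [add_mul, add_mul]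
      omega
    · obtain ⟨-, A, -, hMT⟩ := hS
      exact isMayaTupi_iff.2 ⟨A, hMT⟩

end MayaTupi

theorem mainTheorem3 :
    (∀ k : Fin 11, (forestObstruction k).IsAcyclic ∧
      IsMinimalMTObstruction (forestObstruction k)) ∧
    ∃ (p : RAMProg) (C : ℕ), ∀ (n : ℕ) (G : SimpleGraph (Fin n)), G.IsTree →
      ∀ off nbr : ℕ → ℕ, IsAdjacencyList G off nbr →
        ∃ (t : ℕ) (s : RAMState), Exec (C * n) p (inputState n off nbr) t s ∧ t ≤ C * n ∧
          (IsMayaTupi G → IsYesOutput G s) ∧ (¬ IsMayaTupi G → IsNoOutput G s) := by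
  refine ⟨fun k => ⟨(isDepth_forestObstruction k).isAcyclic,
    isMinimalMTObstruction_forestObstruction k⟩, recognize,
    -- A tree has a vertex, so `203 * n` is at least `3 * n + 200`, the word bound required by the
    -- program. The other summand bounds the running time.
    203 + (searchCost 3 + 10 + allTuples.length * 4650), fun n G hG off nbr hA => ?_⟩
  obtain ⟨r⟩ := hG.connected.nonempty
  have hn := r.2
  obtain ⟨t, s, hx, ht, h⟩ := wp_recognize hG hA
    (W := (203 + (searchCost 3 + 10 + allTuples.length * 4650)) * n) (by
      rw [add_mul]
      omega)
  exact ⟨t, s, hx, ht.trans (Nat.mul_le_mul_right _ (Nat.le_add_left _ _)), h⟩
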